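/- Let $(\mathcal X,\rho)$ be a separable metric space with its Borel $\sigma$-algebra $\mathcal B$, and let $(\mathcal Y,\ell)$ be a separable near-metric space: $\ell:\mathcal Y^2\to[0,\infty)$ is symmetric, $\ell(y_1,y_2)=0$ iff $y_1=y_2$, there is a constant $c_\ell$ with $\ell(y_1,y_3)\le c_\ell(\ell(y_2,y_1)+\ell(y_2,y_3))$ for all $y_1,y_2,y_3$, and $\mathcal Y$ has a countable $\ell$-dense subset. Assume $0<\sup_{y_1,y_2}\ell(y_1,y_2)<\infty$. Equip $\mathcal Y$ with the Borel $\sigma$-algebra of the topology induced by $\ell$, or with any larger $\sigma$-algebra. A learning rule is a sequence $f_\cdot=(f_t)_{t\ge 0}$ of measurable functions $f_t:\mathcal X^{t}\times\mathcal Y^{t}\times\mathcal X\to\mathcal Y$. For a stochastic process $\mathbb X=(X_t)_{t\ge0}$ on a probability space with values in $\mathcal X$, and a measurable target $f^*:\mathcal X\to\mathcal Y$, put $$\mathcal L_{\mathbb X}(f_\cdot,f^*;T)=\frac1T\sum_{t=0}^{T-1}\ell\big(f_t((X_i)_{i<t},(f^*(X_i))_{i<t},X_t),\,f^*(X_t)\big).$$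 The process $\mathbb X$ admits strong (resp. weak) universal online learning if there is a learning rule $f_\cdot$ such that for every measurable $f^*:\mathcal X\to\mathcal Y$, $\mathcal L_{\mathbb X}(f_\cdot,f^*;T)\to0$ almost surely (resp. $\mathbb E\,\mathcal L_{\mathbb X}(f_\cdot,f^*;T)\to0$) as $T\to\infty$. (If $\ell$ is not measurable, $\mathbb E$ denotes the lower integral.) Then: 1. $\mathbb X$ admits strong universal online learning if and only if it satisfies SMV: for every countable measurable partition $(A_k)_{k\ge0}$ of $\mathcal X$, $|\{k: X_t\in A_k\text{ for some }t<T\}|=o(T)$ almost surely. 2. $\mathbb X$ admits weak universal online learning if and only if it satisfies WSMV: for every countable measurable partition $(A_k)_{k\ge0}$ of $\mathcal X$, $\mathbb E\,|\{k: X_t\in A_k\text{ for some }t<T\}|=o(T)$. -/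

import Mathlib

open MeasureTheory Filter Topology Asymptotics
open scoped NNReal ENNReal

namespace UOL

/-- `ℓ : 𝒴² → [0,∞)` is a near-metric: symmetric, discernible, and satisfying a relaxed triangle
inequality with some constant `c`. -/
structure IsNearMetric {𝒴 : Type*} (ℓ : 𝒴 → 𝒴 → ℝ≥0) : Prop where
  symm : ∀ y₁ y₂, ℓ y₁ y₂ = ℓ y₂ y₁
  eq_zero_iff : ∀ y₁ y₂, ℓ y₁ y₂ = 0 ↔ y₁ = y₂
  relaxed_triangle : ∃ c : ℝ≥0, ∀ y₁ y₂ y₃, ℓ y₁ y₃ ≤ c * (ℓ y₂ y₁ + ℓ y₂ y₃)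

/-- Separability of `(𝒴, ℓ)`: there is a countable `ℓ`-dense subset. -/
def IsSeparableLoss {𝒴 : Type*} (ℓ : 𝒴 → 𝒴 → ℝ≥0) : Prop :=
  ∃ s : Set 𝒴, s.Countable ∧ ∀ y : 𝒴, ∀ ε : ℝ≥0, 0 < ε → ∃ z ∈ s, ℓ z y < ε

/-- The loss supremum `sup_{y₁,y₂} ℓ(y₁,y₂)`, an element of `[0,∞]`. -/
noncomputable def supLoss {𝒴 : Type*} (ℓ : 𝒴 → 𝒴 → ℝ≥0) : ℝ≥0∞ :=
  ⨆ (y₁ : 𝒴) (y₂ : 𝒴), (ℓ y₁ y₂ : ℝ≥0∞)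

/-- The topology induced by `ℓ`: a set is open if around each of its points
it contains an `ℓ`-ball of positive radius. -/
@[reducible] def lossTopology {𝒴 : Type*} (ℓ : 𝒴 → 𝒴 → ℝ≥0) : TopologicalSpace 𝒴 where
  IsOpen U := ∀ y ∈ U, ∃ ε : ℝ≥0, 0 < ε ∧ ∀ z, ℓ y z < ε → z ∈ U
  isOpen_univ := fun _ _ => ⟨1, one_pos, fun _ _ => trivial⟩
  isOpen_inter := by
    intro U V hU hV y hy
    obtain ⟨a, ha, hUa⟩ := hU y hy.1
    obtain ⟨b, hb, hVb⟩ := hV y hy.2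
    exact ⟨min a b, lt_min ha hb, fun z hz =>
      ⟨hUa z (hz.trans_le (min_le_left a b)), hVb z (hz.trans_le (min_le_right a b))⟩⟩
  isOpen_sUnion := by
    intro S hS y hy
    obtain ⟨U, hU, hyU⟩ := hy
    obtain ⟨ε, hε, h⟩ := hS U hU y hyU
    exact ⟨ε, hε, fun z hz => ⟨U, hU, h z hz⟩⟩

/-- The Borel `σ`-algebra of the topology induced by `ℓ`. -/
@[reducible] def lossBorel {𝒴 : Type*} (ℓ : 𝒴 → 𝒴 → ℝ≥0) : MeasurableSpace 𝒴 :=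
  @borel 𝒴 (lossTopology ℓ)

/-- A learning rule: for each length `t` of the history, a measurable function of the past
instances, the past values and the new instance. -/
structure LearningRule (𝒳 𝒴 : Type*) [MeasurableSpace 𝒳] [MeasurableSpace 𝒴] where
  predict : (t : ℕ) → (Fin t → 𝒳) × (Fin t → 𝒴) × 𝒳 → 𝒴
  measurable_predict : ∀ t, Measurable (predict t)

section
variable {Ω 𝒳 𝒴 : Type*} [MeasurableSpace Ω] [MeasurableSpace 𝒳] [MeasurableSpace 𝒴]

/-- The prediction of the rule at time `t`, along the realization `ω` of the process `X`,
when the values are `fstar (X t)`. -/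
def prediction (X : ℕ → Ω → 𝒳) (f : LearningRule 𝒳 𝒴) (fstar : 𝒳 → 𝒴) (t : ℕ) (ω : Ω) : 𝒴 :=
  f.predict t (fun i => X i ω, fun i => fstar (X i ω), X t ω)

/-- The average loss of the first `T` predictions. -/
noncomputable def avgLoss (ℓ : 𝒴 → 𝒴 → ℝ≥0) (X : ℕ → Ω → 𝒳) (f : LearningRule 𝒳 𝒴)
    (fstar : 𝒳 → 𝒴) (T : ℕ) (ω : Ω) : ℝ≥0 :=
  (1 / (T : ℝ≥0)) * ∑ t ∈ Finset.range T, ℓ (prediction X f fstar t ω) (fstar (X t ω))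

/-- Strong consistency: the average loss tends to `0` almost surely. -/
def StronglyConsistent (P : Measure Ω) (ℓ : 𝒴 → 𝒴 → ℝ≥0) (X : ℕ → Ω → 𝒳)
    (f : LearningRule 𝒳 𝒴) (fstar : 𝒳 → 𝒴) : Prop :=
  ∀ᵐ ω ∂P, Tendsto (fun T : ℕ => avgLoss ℓ X f fstar T ω) atTop (𝓝 0)

/-- Weak consistency: the expected average loss tends to `0`. -/
def WeaklyConsistent (P : Measure Ω) (ℓ : 𝒴 → 𝒴 → ℝ≥0) (X : ℕ → Ω → 𝒳)
    (f : LearningRule 𝒳 𝒴) (fstar : 𝒳 → 𝒴) : Prop :=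
  Tendsto (fun T : ℕ => ∫⁻ ω, (avgLoss ℓ X f fstar T ω : ℝ≥0∞) ∂P) atTop (𝓝 0)

/-- The processes on `(Ω, P)` with values in `𝒳` admitting strong universal online learning: one
learning rule is strongly consistent for all measurable target functions. -/
def SUOL (P : Measure Ω) (ℓ : 𝒴 → 𝒴 → ℝ≥0) : Set (ℕ → Ω → 𝒳) :=
  {X | (∀ t, Measurable (X t)) ∧ ∃ f : LearningRule 𝒳 𝒴,
    ∀ fstar : 𝒳 → 𝒴, Measurable fstar → StronglyConsistent P ℓ X f fstar}

/-- The processes on `(Ω, P)` with values in `𝒳` admitting weak universal online learning. -/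
def WUOL (P : Measure Ω) (ℓ : 𝒴 → 𝒴 → ℝ≥0) : Set (ℕ → Ω → 𝒳) :=
  {X | (∀ t, Measurable (X t)) ∧ ∃ f : LearningRule 𝒳 𝒴,
    ∀ fstar : 𝒳 → 𝒴, Measurable fstar → WeaklyConsistent P ℓ X f fstar}

/-- A countable measurable partition (cells may be empty). -/
structure IsMeasurablePartition (A : ℕ → Set 𝒳) : Prop where
  measurableSet : ∀ k, MeasurableSet (A k)
  disjoint : Pairwise (Function.onFun Disjoint A)
  iUnion_eq : ⋃ k, A k = Set.univ

/-- The number of cells `A k` visited by the process before time `T`. -/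
noncomputable def visits (A : ℕ → Set 𝒳) (X : ℕ → Ω → 𝒳) (T : ℕ) (ω : Ω) : ℕ :=
  Set.ncard {k : ℕ | ∃ t < T, X t ω ∈ A k}

/-- Sublinear measurable visits: for every countable measurable partition, the number of visited
cells is `o(T)` almost surely. -/
def SMV (P : Measure Ω) : Set (ℕ → Ω → 𝒳) :=
  {X | (∀ t, Measurable (X t)) ∧ ∀ A : ℕ → Set 𝒳, IsMeasurablePartition A →
    ∀ᵐ ω ∂P, (fun T : ℕ => (visits A X T ω : ℝ)) =o[atTop] (fun T : ℕ => (T : ℝ))}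

/-- Weak sublinear measurable visits: for every countable measurable partition, the expected number
of visited cells is `o(T)`. -/
def WSMV (P : Measure Ω) : Set (ℕ → Ω → 𝒳) :=
  {X | (∀ t, Measurable (X t)) ∧ ∀ A : ℕ → Set 𝒳, IsMeasurablePartition A →
    (fun T : ℕ => ∫ ω, (visits A X T ω : ℝ) ∂P) =o[atTop] (fun T : ℕ => (T : ℝ))}

end

end UOL

/-! Sufficiency. Fix a sequence `G` of sets generating the Borel σ-algebra and read membership in `G
0`, `G 1`, ... as binary digits. Distinct points of the process are inserted into a digital search
tree, and each instance receives the value observed at its representative: an earlier occurrence, or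
the point stored at the parent node. This rule uses neither the process nor the target. Its loss is
small as soon as a point and its representative rarely lie in different cells of a countable
partition on whose cells the target is nearly constant (`exists_quantizer`, `avgLoss_treeRule_le`).

That such crossings are negligible is proved for single sets by the π-λ theorem
(`negl_crossingRate_mem`). A set decided by `j` digits is crossed only at depth at most `j`, hence
boundedly often. For a disjoint union, class `i` has few crossings after some time `τ i`. Classes
with `τ i ≤ T` have a summable total. For the others, a tree node has at most two children, so
crossings number at most three times the new points in these classes. With high probability these
points are told apart by `j i` digits within class `i`; they therefore occupy distinct cells of one
fixed countable partition, and visited cells are sublinear by assumption. The same argument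
(`negl_crossingRate_of_classes`) passes from sets to partitions. It is run once for an abstract
functional `q`, specialised to the expectation of the supremum (strong case) and the supremum of the
expectations (weak case).

Necessity. Label the cells of a partition by independent fair coins with two values at positive
loss. The prediction on the first visit of a cell is independent of its coin, hence wrong with
probability one half; thus the mean mistake rate is at least half the rate of visited cells
(`cellRate_le_lintegral`). Consistency for every labelling and Fubini give the claim. -/

namespace UOL

/-! ### Binary digits of points. -/

open Classical in
/-- The first `j` binary digits of `x` relative to the sequence of sets `G`, as a number. -/
noncomputable def code {α : Type*} (G : ℕ → Set α) : ℕ → α → ℕ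
  | 0, _ => 0
  | j + 1, x => 2 * code G j x + (if x ∈ G j then 1 else 0)

section Code
variable {α : Type*} {G : ℕ → Set α} {j k : ℕ} {x y : α}

lemma code_succ_eq_iff : code G (j + 1) x = code G (j + 1) y ↔
    code G j x = code G j y ∧ (x ∈ G j ↔ y ∈ G j) := by
  simp only [code]
  split_ifs <;> simp_all <;> omega

lemma code_lt : code G j x < 2 ^ j := by
  induction j with
  | zero => simp [code]
  | succ j ih =>
    simp only [code, pow_succ]
    split_ifs <;> omega

lemma code_eq_of_le (hjk : j ≤ k) (h : code G k x = code G k y) : code G j x = code G j y := by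
  induction k, hjk using Nat.le_induction with
  | base => exact h
  | succ k _ ih => exact ih (code_succ_eq_iff.1 h).1

/-- Newer digits are less significant, so division truncates to a prefix. This lets conditions on
different numbers of digits be written at a common level. -/
lemma code_eq_div (hjk : j ≤ k) : code G j x = code G k x / 2 ^ (k - j) := by
  induction k, hjk using Nat.le_induction with
  | base => simp
  | succ k hk ih =>
    rw [Nat.succ_sub hk, pow_succ', ← Nat.div_div_eq_div_mul, ih]
    congr 1
    simp only [code]
    split_ifs <;> omega

lemma measurable_code [MeasurableSpace α] (hG : ∀ k, MeasurableSet (G k)) (j : ℕ) :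
    Measurable (code G j) := by
  induction j with
  | zero => exact measurable_const
  | succ j ih => exact (ih.const_mul 2).add (Measurable.ite (hG j) measurable_const measurable_const)

/-- The sets that are determined by finitely many binary digits form a `π`-system. -/
lemma isPiSystem_code (G : ℕ → Set α) : IsPiSystem {s | ∃ j U, s = code G j ⁻¹' U} := by
  rintro _ ⟨j, U, rfl⟩ _ ⟨k, V, rfl⟩ -
  refine ⟨max j k, (fun n => n / 2 ^ (max j k - j)) ⁻¹' U ∩ (fun n => n / 2 ^ (max j k - k)) ⁻¹' V,
    ?_⟩
  ext x
  simp [← code_eq_div]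

lemma generateFrom_code (G : ℕ → Set α) :
    MeasurableSpace.generateFrom {s | ∃ j U, s = code G j ⁻¹' U} =
      MeasurableSpace.generateFrom (Set.range G) := by
  apply le_antisymm
  · refine MeasurableSpace.generateFrom_le ?_
    rintro _ ⟨j, U, rfl⟩
    let _ := MeasurableSpace.generateFrom (Set.range G)
    exact measurable_code (fun k => MeasurableSpace.measurableSet_generateFrom (Set.mem_range_self k)) j
      (.of_discrete)
  · refine MeasurableSpace.generateFrom_le ?_
    rintro _ ⟨k, rfl⟩
    -- The last of the first `k + 1` digits, i.e. the parity of the code, records membership in `G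
    -- k`.
    refine MeasurableSpace.measurableSet_generateFrom ⟨k + 1, {n | n % 2 = 1}, ?_⟩
    ext x
    by_cases h : x ∈ G k <;> simp [code, h]

/-- The sets that do not separate `x` from `y` form a σ-algebra; it contains every `G k`, hence the
singleton `{x}`. -/
lemma eq_of_forall_code_eq [MeasurableSpace α] [MeasurableSingletonClass α]
    (hG : MeasurableSpace.generateFrom (Set.range G) = ‹MeasurableSpace α›)
    (h : ∀ j, code G j x = code G j y) : x = y := by
  have key : ∀ s : Set α, MeasurableSet s → (x ∈ s ↔ y ∈ s) := by
    intro s hs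
    rw [← hG] at hs
    induction s, hs using MeasurableSpace.generateFrom_induction with
    | hC s hs _ =>
      obtain ⟨k, rfl⟩ := hs
      exact (code_succ_eq_iff.1 (h (k + 1))).2
    | empty => simp
    | compl s _ ih => simp [ih]
    | iUnion s _ ih => simp [ih]
  exact ((key {x} (measurableSet_singleton x)).1 rfl).symm

end Code

/-! ### The digital search tree. -/

/-- `x t` differs from all earlier terms. -/
def IsNew {α : Type*} (x : ℕ → α) (t : ℕ) : Prop := ∀ s < t, x s ≠ x t

/-- The depth at which `x t` is stored in the digital search tree of the sequence `x`: each node of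
the binary tree stores the first new point that reaches it. -/
noncomputable def depth {α : Type*} (G : ℕ → Set α) (x : ℕ → α) (t : ℕ) : ℕ :=
  sInf {d | ∀ s (_ : s < t), IsNew x s → depth G x s = d → code G d (x s) ≠ code G d (x t)}
termination_by t

/-- `x s` is an earlier occurrence of `x t`, or it is stored at the parent node of `x t`. -/
def Link {α : Type*} (G : ℕ → Set α) (x : ℕ → α) (s t : ℕ) : Prop :=
  s < t ∧ (x s = x t ∨ (IsNew x s ∧ IsNew x t ∧ depth G x s + 1 = depth G x t ∧
    code G (depth G x s) (x s) = code G (depth G x s) (x t)))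

open Classical in
/-- The representative of time `t` among the earlier times; equal to `t` if there is none. -/
noncomputable def parent {α : Type*} (G : ℕ → Set α) (x : ℕ → α) (t : ℕ) : ℕ :=
  if h : ∃ s, Link G x s t then Nat.find h else t

section Tree
variable {α β : Type*} {G : ℕ → Set α} {x : ℕ → α} {s t d j : ℕ}

lemma depth_spec (G : ℕ → Set α) (x : ℕ → α) (t : ℕ) (hst : s < t) (hs : IsNew x s)
    (h : depth G x s = depth G x t) : code G (depth G x t) (x s) ≠ code G (depth G x t) (x t) := by
  have hne : {d | ∀ s (_ : s < t), IsNew x s → depth G x s = d →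
      code G d (x s) ≠ code G d (x t)}.Nonempty := by
    -- At a depth not taken by any earlier term the condition is vacuous, so the infimum is
    -- attained.
    obtain ⟨d, hd⟩ := Infinite.exists_notMem_finset ((Finset.range t).image (depth G x))
    refine ⟨d, fun s hs _ h => (hd ?_).elim⟩
    exact Finset.mem_image.2 ⟨s, Finset.mem_range.2 hs, h⟩
  have := Nat.sInf_mem hne
  rw [← depth] at this
  exact this s hst hs h

lemma exists_of_lt_depth (h : d < depth G x t) :
    ∃ s < t, IsNew x s ∧ depth G x s = d ∧ code G d (x s) = code G d (x t) := by
  rw [depth] at h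
  have := Nat.notMem_of_lt_sInf h
  simp only [Set.mem_ofPred_eq] at this
  push Not at this
  obtain ⟨s, hst, hs, hd, hc⟩ := this
  exact ⟨s, hst, hs, hd, hc⟩

/-- A node is a depth together with a code of that length; it stores at most one new point. -/
lemma eq_of_depth_eq (hs : IsNew x s) (ht : IsNew x t) (h : depth G x s = depth G x t)
    (hc : code G (depth G x t) (x s) = code G (depth G x t) (x t)) : s = t := by
  rcases lt_trichotomy s t with hst | hst | hst
  · exact (depth_spec G x t hst hs h hc).elim
  · exact hst
  · exact (depth_spec G x s hst ht h.symm (h ▸ hc.symm)).elim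

lemma isNew_zero (x : ℕ → α) : IsNew x 0 := fun _ h => absurd h (Nat.not_lt_zero _)

lemma depth_zero (G : ℕ → Set α) (x : ℕ → α) : depth G x 0 = 0 := by
  by_contra h
  obtain ⟨s, hs, -⟩ := exists_of_lt_depth (Nat.pos_of_ne_zero h)
  exact Nat.not_lt_zero _ hs

lemma exists_link (ht : 0 < t) : ∃ s, Link G x s t := by
  by_cases hn : IsNew x t
  -- The root is already occupied by `x 0`.
  · have hd : depth G x t ≠ 0 := fun h =>
      ht.ne (eq_of_depth_eq (isNew_zero x) hn (by rw [h, depth_zero]) (by rw [h]; rfl))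
    obtain ⟨d, hd⟩ := Nat.exists_eq_succ_of_ne_zero hd
    obtain ⟨s, hst, hs, hsd, hc⟩ := exists_of_lt_depth (d := d) (G := G) (x := x) (t := t) (by omega)
    exact ⟨s, hst, Or.inr ⟨hs, hn, by omega, by rwa [hsd]⟩⟩
  · simp only [IsNew] at hn
    push Not at hn
    obtain ⟨s, hst, h⟩ := hn
    exact ⟨s, hst, Or.inl h⟩

lemma link_parent (ht : 0 < t) : Link G x (parent G x t) t := by
  classical
  rw [parent, dif_pos (exists_link ht)]
  exact Nat.find_spec (exists_link ht)

lemma parent_zero (G : ℕ → Set α) (x : ℕ → α) : parent G x 0 = 0 := by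
  rw [parent, dif_neg]
  rintro ⟨s, hs, -⟩
  exact Nat.not_lt_zero _ hs

lemma parent_lt (ht : 0 < t) : parent G x t < t := (link_parent ht).1

lemma apply_parent_of_not_isNew (ht : ¬ IsNew x t) : x (parent G x t) = x t := by
  have h0 : 0 < t := Nat.pos_of_ne_zero fun h => ht (h ▸ isNew_zero x)
  exact (link_parent h0).2.resolve_right fun h => ht h.2.1

lemma link_of_new (ht : IsNew x t) (h0 : 0 < t) :
    IsNew x (parent G x t) ∧ depth G x (parent G x t) + 1 = depth G x t ∧
      code G (depth G x (parent G x t)) (x (parent G x t)) =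
        code G (depth G x (parent G x t)) (x t) := by
  obtain ⟨hlt, h | h⟩ := link_parent (G := G) (x := x) h0
  · exact (ht _ hlt h).elim
  · exact ⟨h.1, h.2.2⟩

lemma code_parent (ht : IsNew x t) (hj : j < depth G x t) :
    code G j (x (parent G x t)) = code G j (x t) := by
  rcases Nat.eq_zero_or_pos t with rfl | h0
  · rw [parent_zero]
  · obtain ⟨-, hd, hc⟩ := link_of_new (G := G) ht h0
    exact code_eq_of_le (by omega) hc

open Classical in
/-- Each node of a binary tree has at most two children. -/
lemma card_children_le (s T : ℕ) :
    {t ∈ Finset.range T | IsNew x t ∧ 0 < t ∧ parent G x t = s}.card ≤ 2 := by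
  let p := code G (depth G x s) (x s)
  calc _ ≤ ({2 * p, 2 * p + 1} : Finset ℕ).card := by
        refine Finset.card_le_card_of_injOn (fun t => code G (depth G x s + 1) (x t)) ?_ ?_
        · intro t ht
          simp only [Finset.coe_filter, Set.mem_ofPred_eq, Finset.mem_range] at ht
          obtain ⟨-, ht, h0, rfl⟩ := ht
          obtain ⟨-, -, hc⟩ := link_of_new (G := G) ht h0
          simp only [code, ← hc, Finset.coe_insert, Finset.coe_singleton, Set.mem_insert_iff,
            Set.mem_singleton_iff, p]
          split_ifs <;> simp
        · intro t ht t' ht' h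
          simp only [Finset.coe_filter, Set.mem_ofPred_eq, Finset.mem_range] at ht ht'
          obtain ⟨-, ht, h0, hp⟩ := ht
          obtain ⟨-, ht', h0', hp'⟩ := ht'
          have h1 := (link_of_new (G := G) ht h0).2.1
          have h2 := (link_of_new (G := G) ht' h0').2.1
          rw [hp] at h1
          rw [hp'] at h2
          refine eq_of_depth_eq ht ht' (G := G) (by omega) ?_
          rwa [← h2]
    _ ≤ 2 := Finset.card_le_two

open Classical in
lemma card_depth_le (j T : ℕ) :
    {t ∈ Finset.range T | IsNew x t ∧ depth G x t ≤ j}.card ≤ (j + 1) * 2 ^ j := by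
  calc _ ≤ (Finset.range (j + 1) ×ˢ Finset.range (2 ^ j)).card := by
        refine Finset.card_le_card_of_injOn (fun t => (depth G x t, code G (depth G x t) (x t)))
          ?_ ?_
        · intro t ht
          simp only [Finset.coe_filter, Set.mem_ofPred_eq, Finset.mem_range] at ht
          simp only [Finset.coe_product, Finset.coe_range, Set.mem_prod, Set.mem_Iio]
          exact ⟨by omega, code_lt.trans_le (Nat.pow_le_pow_right two_pos ht.2.2)⟩
        · intro t ht t' ht' h
          simp only [Finset.coe_filter, Set.mem_ofPred_eq, Prod.mk.injEq] at ht ht' h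
          refine eq_of_depth_eq ht.2.1 ht'.2.1 h.1 ?_
          rw [← h.1, h.2, h.1]
    _ = _ := by simp

end Tree

/-! ### Counting crossings. -/

open Classical in
/-- The times before `T` at which `κ` differs between a point and its representative. -/
noncomputable def crossings {α β : Type*} (G : ℕ → Set α) (κ : α → β) (x : ℕ → α) (T : ℕ) :
    Finset ℕ :=
  {t ∈ Finset.range T | κ (x (parent G x t)) ≠ κ (x t)}

section Crossings
variable {α β : Type*} {G : ℕ → Set α} {κ : α → β} {x : ℕ → α} {s t T j : ℕ}

lemma mem_crossings : t ∈ crossings G κ x T ↔ t < T ∧ κ (x (parent G x t)) ≠ κ (x t) := by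
  simp [crossings]

lemma card_crossings_le : (crossings G κ x T).card ≤ T := by
  refine (Finset.card_le_card fun t ht => ?_).trans (Finset.card_range T).le
  exact Finset.mem_range.2 (mem_crossings.1 ht).1

lemma isNew_of_ne (h : κ (x (parent G x t)) ≠ κ (x t)) : IsNew x t ∧ 0 < t := by
  refine ⟨?_, Nat.pos_of_ne_zero ?_⟩
  · by_contra hn
    exact h (by rw [apply_parent_of_not_isNew hn])
  · rintro rfl
    exact h (by rw [parent_zero])

/-- A new point deeper than `j` shares its first `j` digits with its parent, so only points of depth
at most `j` can be crossings. -/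
lemma card_crossings_code_le (γ : ℕ → β) :
    (crossings G (fun y => γ (code G j y)) x T).card ≤ (j + 1) * 2 ^ j := by
  classical
  refine le_trans (Finset.card_le_card fun t ht => ?_) (card_depth_le (G := G) (x := x) j T)
  obtain ⟨htT, h⟩ := mem_crossings.1 ht
  have hn := (isNew_of_ne (κ := fun y => γ (code G j y)) h).1
  simp only [Finset.mem_filter, Finset.mem_range]
  refine ⟨htT, hn, ?_⟩
  by_contra hd
  exact h (by simp only [code_parent hn (not_le.1 hd)])

open Classical in
/-- The crossings that involve the values in `I` are at most three times the number of new points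
with values in `I`. -/
lemma card_crossings_filter_le (I : Set β) :
    {t ∈ crossings G κ x T | κ (x t) ∈ I ∨ κ (x (parent G x t)) ∈ I}.card ≤
      3 * {t ∈ Finset.range T | IsNew x t ∧ κ (x t) ∈ I}.card := by
  set N := {t ∈ Finset.range T | IsNew x t ∧ κ (x t) ∈ I} with hN
  calc _ ≤ (N ∪ N.biUnion fun s =>
        {t ∈ Finset.range T | IsNew x t ∧ 0 < t ∧ parent G x t = s}).card := by
        refine Finset.card_le_card fun t ht => ?_
        obtain ⟨hc, h⟩ := Finset.mem_filter.1 ht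
        obtain ⟨htT, hc⟩ := mem_crossings.1 hc
        obtain ⟨hn, h0⟩ := isNew_of_ne hc
        rcases h with h | h
        · exact Finset.mem_union_left _ (by simp [hN, htT, hn, h])
        · refine Finset.mem_union_right _ (Finset.mem_biUnion.2 ⟨parent G x t, ?_, ?_⟩)
          · have := (parent_lt (G := G) (x := x) h0).trans htT
            simp [hN, h, this, (link_of_new (G := G) hn h0).1]
          · simp [htT, hn, h0]
    -- A crossing either is itself a point of `N` or is one of the at most two children of such a
    -- point.
    _ ≤ N.card + N.card * 2 := (Finset.card_union_le _ _).trans <|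
        Nat.add_le_add_left (Finset.card_biUnion_le_card_mul _ _ _ fun s _ =>
          card_children_le s T) _
    _ = 3 * N.card := by ring

end Crossings

/-! ### Dependence on the past and measurability of the tree. -/

section Congr
variable {α : Type*} {G : ℕ → Set α} {x y : ℕ → α} {s t : ℕ}

/-- Replaces the infimum by conditions on earlier depths only, which makes measurability provable by
strong induction on time. -/
lemma depth_eq_iff {d : ℕ} : depth G x t = d ↔
    (∀ s < t, IsNew x s → depth G x s = d → code G d (x s) ≠ code G d (x t)) ∧
      ∀ d' < d, ∃ s < t, IsNew x s ∧ depth G x s = d' ∧ code G d' (x s) = code G d' (x t) := by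
  constructor
  · rintro rfl
    exact ⟨fun s hs => depth_spec G x t hs, fun d' => exists_of_lt_depth⟩
  · rintro ⟨h1, h2⟩
    refine le_antisymm ?_ (not_lt.1 fun h => ?_)
    · rw [depth]
      exact Nat.sInf_le h1
    · obtain ⟨s, hs, hn, hd, hc⟩ := h2 _ h
      exact depth_spec G x t hs hn hd hc

lemma isNew_congr (h : ∀ s ≤ t, x s = y s) : IsNew x t ↔ IsNew y t :=
  forall₂_congr fun s hs => by rw [h s hs.le, h t le_rfl]

lemma depth_congr (h : ∀ s ≤ t, x s = y s) : depth G x t = depth G y t := by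
  induction t using Nat.strong_induction_on with
  | _ t ih =>
    rw [depth, depth]
    congr 1
    ext d
    refine forall₂_congr fun s hs => ?_
    have hs' : ∀ r ≤ s, x r = y r := fun r hr => h r (hr.trans hs.le)
    rw [isNew_congr hs', ih s hs hs', h s hs.le, h t le_rfl]

lemma link_congr (h : ∀ s ≤ t, x s = y s) : Link G x s t ↔ Link G y s t := by
  refine and_congr_right fun hs => ?_
  have hs' : ∀ r ≤ s, x r = y r := fun r hr => h r (hr.trans hs.le)
  rw [isNew_congr hs', isNew_congr h, depth_congr hs', depth_congr h, h s hs.le, h t le_rfl]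

lemma parent_congr (h : ∀ s ≤ t, x s = y s) : parent G x t = parent G y t := by
  have : (fun s => Link G x s t) = fun s => Link G y s t := funext fun s => propext (link_congr h)
  classical
  simp only [parent, congrFun this]

end Congr

lemma measurable_code_eq {α : Type*} [MeasurableSpace α] {G : ℕ → Set α}
    (hG : ∀ k, MeasurableSet (G k)) (d s t : ℕ) :
    Measurable fun x : ℕ → α => code G d (x s) = code G d (x t) :=
  measurableSet_setOfPred.1 (measurableSet_eq_fun
    ((measurable_code hG d).comp (measurable_pi_apply s))
    ((measurable_code hG d).comp (measurable_pi_apply t)))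

section Measurability
variable {α : Type*} [MeasurableSpace α] [MeasurableEq α] {G : ℕ → Set α}

lemma measurable_isNew (t : ℕ) : Measurable fun x : ℕ → α => IsNew x t := by
  refine Measurable.forall fun s => Measurable.imp measurable_const (Measurable.not ?_)
  exact measurableSet_setOfPred.1
    (measurableSet_eq_fun (measurable_pi_apply s) (measurable_pi_apply t))

lemma measurable_depth (hG : ∀ k, MeasurableSet (G k)) (t : ℕ) :
    Measurable fun x : ℕ → α => depth G x t := by
  induction t using Nat.strong_induction_on with
  | _ t ih =>
    refine measurable_to_countable' fun d => ?_
    have : (fun x : ℕ → α => depth G x t) ⁻¹' {d} = {x | (∀ s : Fin t, IsNew x s →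
        depth G x s = d → ¬ code G d (x s) = code G d (x t)) ∧
        ∀ d' : Fin d, ∃ s : Fin t, IsNew x s ∧ depth G x s = d' ∧
          code G d' (x s) = code G d' (x t)} := by
      ext x
      rw [Set.mem_preimage, Set.mem_singleton_iff, depth_eq_iff]
      simp only [Fin.forall_iff, Fin.exists_iff, ne_eq, exists_prop, Set.mem_ofPred_eq]
    rw [this]
    have hd : ∀ (s : Fin t) (e : ℕ), Measurable fun x : ℕ → α => depth G x s = e :=
      fun s e => (ih s s.2).eq_const e
    refine Measurable.setOf (.and (.forall fun s => ?_) (.forall fun d' => .exists fun s => ?_))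
    · exact (measurable_isNew _).imp ((hd s d).imp (measurable_code_eq hG _ _ _).not)
    · exact (measurable_isNew _).and ((hd s d').and (measurable_code_eq hG _ _ _))

lemma measurable_link (hG : ∀ k, MeasurableSet (G k)) (s t : ℕ) :
    Measurable fun x : ℕ → α => Link G x s t := by
  refine measurable_const.and (.or ?_ ((measurable_isNew s).and ((measurable_isNew t).and
    (.and ?_ ?_))))
  · exact measurableSet_setOfPred.1
      (measurableSet_eq_fun (measurable_pi_apply s) (measurable_pi_apply t))
  · exact measurableSet_setOfPred.1
      (measurableSet_eq_fun ((measurable_depth hG s).add_const 1) (measurable_depth hG t))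
  · have : (fun x : ℕ → α => code G (depth G x s) (x s) = code G (depth G x s) (x t)) =
        fun x => ∃ d, depth G x s = d ∧ code G d (x s) = code G d (x t) := by
      ext x
      simp
    rw [this]
    exact .exists fun d => ((measurable_depth hG s).eq_const d).and (measurable_code_eq hG _ _ _)

lemma measurable_parent (hG : ∀ k, MeasurableSet (G k)) (t : ℕ) :
    Measurable fun x : ℕ → α => parent G x t := by
  classical
  refine measurable_to_countable' fun r => ?_
  have : (fun x : ℕ → α => parent G x t) ⁻¹' {r} =
      {x | ((∃ s, Link G x s t) ∧ Link G x r t ∧ ∀ s, s < r → ¬ Link G x s t) ∨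
        ((¬ ∃ s, Link G x s t) ∧ t = r)} := by
    ext x
    by_cases h : ∃ s, Link G x s t
    · rw [Set.mem_preimage, parent, dif_pos h, Set.mem_singleton_iff, Nat.find_eq_iff]
      simp [h]
    · rw [Set.mem_preimage, parent, dif_neg h, Set.mem_singleton_iff]
      simp [not_exists.1 h]
  rw [this]
  have hl := fun s => measurable_link hG s t
  exact Measurable.setOf (.or (.and (.exists hl) ((hl r).and (.forall fun s =>
    measurable_const.imp (hl s).not))) ((Measurable.exists hl).not.and measurable_const))

lemma measurable_apply_parent (hG : ∀ k, MeasurableSet (G k)) (t : ℕ) :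
    Measurable fun x : ℕ → α => x (parent G x t) := by
  have : Measurable fun p : ℕ × (ℕ → α) => p.2 p.1 :=
    measurable_from_prod_countable_right fun n => measurable_pi_apply n
  exact this.comp ((measurable_parent hG t).prodMk measurable_id)

end Measurability

/-! ### The learning rule. -/

/-- The sequence that starts with `xs` and continues with copies of `x`. -/
def extend {α : Type*} {t : ℕ} (xs : Fin t → α) (x : α) (i : ℕ) : α :=
  if h : i < t then xs ⟨i, h⟩ else x

lemma measurable_extend {α : Type*} [MeasurableSpace α] (t : ℕ) :
    Measurable fun p : (Fin t → α) × α => extend p.1 p.2 := by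
  refine measurable_pi_lambda _ fun i => ?_
  by_cases h : i < t
  · simpa only [extend, dif_pos h] using measurable_fst.eval
  · simpa only [extend, dif_neg h] using measurable_snd

/-- The rule that predicts the value observed at the representative of the new instance. -/
noncomputable def treeRule {α β : Type*} [MeasurableSpace α] [MeasurableEq α] [MeasurableSpace β]
    {G : ℕ → Set α} (hG : ∀ k, MeasurableSet (G k)) (y₀ : β) : LearningRule α β where
  predict t p := extend p.2.1 y₀ (parent G (extend p.1 p.2.2) t)
  measurable_predict t := by
    have h1 : Measurable fun p : ℕ × (ℕ → β) => p.2 p.1 :=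
      measurable_from_prod_countable_right fun n => measurable_pi_apply n
    have h2 : Measurable fun p : (Fin t → α) × (Fin t → β) × α =>
        parent G (extend p.1 p.2.2) t :=
      (measurable_parent hG t).comp ((measurable_extend t).comp
        (measurable_fst.prodMk measurable_snd.snd))
    have h3 : Measurable fun p : (Fin t → α) × (Fin t → β) × α => extend p.2.1 y₀ :=
      (measurable_extend t).comp (measurable_snd.fst.prodMk measurable_const)
    exact h1.comp (h2.prodMk h3)

/-- The padding of the instances is invisible, since `parent` at `t` depends only on terms up to
`t`. The default `y₀` is used only at time `0`. -/
lemma prediction_treeRule {Ω α β : Type*} [MeasurableSpace Ω] [MeasurableSpace α] [MeasurableEq α]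
    [MeasurableSpace β] {G : ℕ → Set α} (hG : ∀ k, MeasurableSet (G k)) (y₀ : β) (X : ℕ → Ω → α)
    (f : α → β) {t : ℕ} (ht : 0 < t) (ω : Ω) :
    prediction X (treeRule hG y₀) f t ω = f (X (parent G (fun i => X i ω) t) ω) := by
  have : parent G (extend (fun i : Fin t => X i ω) (X t ω)) t = parent G (fun i => X i ω) t := by
    refine parent_congr fun s hs => ?_
    rcases hs.eq_or_lt with rfl | h
    · simp [extend]
    · simp [extend, h]
  simp only [prediction, treeRule, this]
  rw [extend, dif_pos (parent_lt ht)]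

/-! ### Splitting crossings by class. -/

/-- The number of values of `κ` along the first `T` terms of `x`. -/
def cells {α : Type*} (κ : α → ℕ) (x : ℕ → α) (T : ℕ) : ℕ :=
  ((Finset.range T).image fun t => κ (x t)).card

/-- Classes with `τ i ≤ T` are counted one by one. In a class with `T < τ i`, the points seen before
`T` are separated by `j i` digits, so its new points lie in distinct cells of the refined partition.
-/
lemma card_crossings_le_sum {α : Type*} {G : ℕ → Set α} {x : ℕ → α} {κ : α → ℕ} {τ j : ℕ → ℕ}
    (hsep : ∀ i, ∀ s ≤ τ i, ∀ t ≤ τ i, code G (j i) (x s) = code G (j i) (x t) → x s = x t)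
    (T : ℕ) : ∃ F : Finset ℕ, (∀ i ∈ F, i ≠ 0 ∧ τ i ≤ T) ∧ (crossings G κ x T).card ≤
      ∑ i ∈ F, (crossings G (fun y => κ y = i) x T).card +
        3 * cells (fun y => Nat.pair (κ y) (code G (j (κ y)) y)) x T := by
  classical
  set F := {i ∈ (Finset.range T).image fun t => κ (x t) | i ≠ 0 ∧ τ i ≤ T} with hF
  refine ⟨F, fun i hi => (Finset.mem_filter.1 hi).2, ?_⟩
  set I : Set ℕ := {i | T < τ i} with hI
  have hN : {t ∈ Finset.range T | IsNew x t ∧ κ (x t) ∈ I}.card ≤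
      cells (fun y => Nat.pair (κ y) (code G (j (κ y)) y)) x T := by
    refine Finset.card_le_card_of_injOn
      (fun t => Nat.pair (κ (x t)) (code G (j (κ (x t))) (x t))) (fun t ht => ?_) ?_
    · exact Finset.mem_image_of_mem _ (Finset.mem_filter.1 ht).1
    · intro s hs t ht h
      simp only [Finset.coe_filter, Finset.mem_range, Set.mem_ofPred_eq] at hs ht
      obtain ⟨hsT, hs, hsI⟩ := hs
      obtain ⟨htT, ht, htI⟩ := ht
      obtain ⟨h1, h2⟩ := Nat.pair_eq_pair.1 h
      rw [h1] at h2
      have htI' : T < τ (κ (x t)) := htI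
      have hst : x s = x t := hsep _ s (by omega) t (by omega) h2
      by_contra hne
      rcases Nat.lt_or_gt_of_ne hne with h | h
      · exact ht s h hst
      · exact hs t h hst.symm
  have hsub : crossings G κ x T ⊆
      (F.biUnion fun i => crossings G (fun y => κ y = i) x T) ∪
        {t ∈ crossings G κ x T | κ (x t) ∈ I ∨ κ (x (parent G x t)) ∈ I} := by
    intro t ht
    by_cases hP : κ (x t) ∈ I ∨ κ (x (parent G x t)) ∈ I
    · exact Finset.mem_union_right _ (Finset.mem_filter.2 ⟨ht, hP⟩)
    refine Finset.mem_union_left _ (Finset.mem_biUnion.2 ?_)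
    obtain ⟨htT, hne⟩ := mem_crossings.1 ht
    have h0 := parent_lt (G := G) (x := x) (isNew_of_ne hne).2
    simp only [hI, Set.mem_ofPred_eq, not_or, not_lt] at hP
    -- Class `0` is excluded from `F`; a crossing into it is charged to the class of the parent,
    -- which is then nonzero.
    by_cases hz : κ (x t) = 0
    · refine ⟨κ (x (parent G x t)), Finset.mem_filter.2 ⟨?_, ?_, hP.2⟩, mem_crossings.2 ⟨htT, ?_⟩⟩
      · exact Finset.mem_image.2 ⟨_, Finset.mem_range.2 (h0.trans htT), rfl⟩
      · exact fun h => hne (h.trans hz.symm)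
      · simpa using fun h => hne h.symm
    · refine ⟨κ (x t), Finset.mem_filter.2 ⟨?_, hz, hP.1⟩, mem_crossings.2 ⟨htT, ?_⟩⟩
      · exact Finset.mem_image.2 ⟨_, Finset.mem_range.2 htT, rfl⟩
      · simpa using hne
  have h3 : {t ∈ crossings G κ x T | κ (x t) ∈ I ∨ κ (x (parent G x t)) ∈ I}.card ≤
      3 * {t ∈ Finset.range T | IsNew x t ∧ κ (x t) ∈ I}.card := by
    convert card_crossings_filter_le (G := G) (κ := κ) (x := x) (T := T) I
  calc _ ≤ _ := Finset.card_le_card hsub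
    _ ≤ _ := Finset.card_union_le _ _
    _ ≤ _ := Nat.add_le_add Finset.card_biUnion_le
      (h3.trans (Nat.mul_le_mul_left 3 hN))

/-! ### An abstract notion of negligibility. -/

/-- A monotone, countably subadditive functional on nonnegative processes, compatible with `P`. -/
structure IsMode {Ω : Type*} [MeasurableSpace Ω] (P : Measure Ω)
    (q : (ℕ → Ω → ℝ≥0∞) → ℝ≥0∞) : Prop where
  mono : ∀ {Z W : ℕ → Ω → ℝ≥0∞}, (∀ T ω, Z T ω ≤ W T ω) → q Z ≤ q W
  tsum_le : ∀ Z : ℕ → ℕ → Ω → ℝ≥0∞, (∀ i T, Measurable (Z i T)) →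
    q (fun T ω => ∑' i, Z i T ω) ≤ ∑' i, q (Z i)
  indicator_le : ∀ {E : Set Ω}, MeasurableSet E → q (fun _ => E.indicator 1) ≤ P E
  const_le : ∀ c : ℝ≥0∞, q (fun _ _ => c) ≤ c

/-- The process `Z` is negligible in the long run, as measured by `q`. -/
def Negl {Ω : Type*} (q : (ℕ → Ω → ℝ≥0∞) → ℝ≥0∞) (Z : ℕ → Ω → ℝ≥0∞) : Prop :=
  ∀ ε : ℝ≥0∞, 0 < ε → ∃ n, q (fun T ω => if n ≤ T then Z T ω else 0) ≤ ε

section Mode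
variable {Ω : Type*} [MeasurableSpace Ω] {P : Measure Ω} {q : (ℕ → Ω → ℝ≥0∞) → ℝ≥0∞}
  {Z W : ℕ → Ω → ℝ≥0∞}

lemma IsMode.add_le (hq : IsMode P q) (hZ : ∀ T, Measurable (Z T)) (hW : ∀ T, Measurable (W T)) :
    q (fun T ω => Z T ω + W T ω) ≤ q Z + q W := by
  let V : ℕ → ℕ → Ω → ℝ≥0∞ := fun i => if i = 0 then Z else if i = 1 then W else fun _ _ => 0
  -- The two processes are padded by zeros; `φ` will be both `q` and evaluation at a point `(T, ω)`.
  have hV : ∀ (φ : (ℕ → Ω → ℝ≥0∞) → ℝ≥0∞), φ (fun _ _ => 0) = 0 →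
      ∑' i, φ (V i) = φ Z + φ W := by
    intro φ h0
    rw [tsum_eq_sum (s := {0, 1})]
    · simp [V]
    · intro i hi
      simp only [Finset.mem_insert, Finset.mem_singleton, not_or] at hi
      simp [V, hi, h0]
  rw [← hV q (le_antisymm (hq.const_le 0) bot_le)]
  refine le_trans (hq.mono fun T ω => ?_) (hq.tsum_le V fun i T => ?_)
  · exact (hV (fun Y => Y T ω) rfl).ge
  · by_cases h0 : i = 0
    · simpa [V, h0] using hZ T
    · by_cases h1 : i = 1
      · simpa [V, h1] using hW T
      · simp only [V, h0, h1, if_false]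
        exact measurable_const

lemma Negl.mono (hq : IsMode P q) (hW : Negl q W) (h : ∀ T ω, Z T ω ≤ W T ω) : Negl q Z := by
  intro ε hε
  obtain ⟨n, hn⟩ := hW ε hε
  refine ⟨n, le_trans (hq.mono fun T ω => ?_) hn⟩
  split_ifs
  · exact h T ω
  · exact le_rfl

lemma negl_const_div (hq : IsMode P q) (C : ℕ) : Negl q fun T _ => (C : ℝ≥0∞) / (T : ℝ≥0∞) := by
  intro ε hε
  have : Tendsto (fun T : ℕ => (C : ℝ≥0∞) / (T : ℝ≥0∞)) atTop (𝓝 0) := by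
    have := ENNReal.Tendsto.const_div (a := (C : ℝ≥0∞)) ENNReal.tendsto_nat_nhds_top
      (Or.inr (ENNReal.natCast_ne_top C))
    simpa using this
  obtain ⟨n, hn⟩ := eventually_atTop.1 (ENNReal.tendsto_nhds_zero.1 this ε hε)
  refine ⟨n, le_trans (hq.mono fun T ω => ?_) (hq.const_le ε)⟩
  split_ifs with h
  · exact hn T h
  · exact bot_le

end Mode

/-! ### Crossings are negligible under sublinear visits. -/

section Sufficiency
variable {Ω α : Type*} [MeasurableSpace Ω] {P : Measure Ω} [IsProbabilityMeasure P]
  [MeasurableSpace α] [MeasurableEq α] {q : (ℕ → Ω → ℝ≥0∞) → ℝ≥0∞} {G : ℕ → Set α}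
  {X : ℕ → Ω → α}

/-- The frequency of crossings. -/
noncomputable def crossingRate {Ω α β : Type*} (G : ℕ → Set α) (κ : α → β) (X : ℕ → Ω → α) (T : ℕ)
    (ω : Ω) : ℝ≥0∞ :=
  ((crossings G κ (fun t => X t ω) T).card : ℝ≥0∞) / (T : ℝ≥0∞)

/-- The frequency of visits of new cells. -/
noncomputable def cellRate {Ω α : Type*} (κ : α → ℕ) (X : ℕ → Ω → α) (T : ℕ) (ω : Ω) : ℝ≥0∞ :=
  (cells κ (fun t => X t ω) T : ℝ≥0∞) / (T : ℝ≥0∞)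

lemma crossingRate_le_one {Ω α β : Type*} (G : ℕ → Set α) (κ : α → β) (X : ℕ → Ω → α) (T : ℕ)
    (ω : Ω) : crossingRate G κ X T ω ≤ 1 :=
  ENNReal.div_le_of_le_mul (by simpa using card_crossings_le)

lemma cells_le {α : Type*} (κ : α → ℕ) (x : ℕ → α) (T : ℕ) : cells κ x T ≤ T :=
  Finset.card_image_le.trans (Finset.card_range T).le

lemma cellRate_le_one {Ω α : Type*} (κ : α → ℕ) (X : ℕ → Ω → α) (T : ℕ) (ω : Ω) :
    cellRate κ X T ω ≤ 1 :=
  ENNReal.div_le_of_le_mul (by simpa using cells_le _ _ _)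

lemma measurable_crossingRate {β : Type*} [MeasurableSpace β] [MeasurableEq β]
    (hG : ∀ k, MeasurableSet (G k)) {κ : α → β} (hκ : Measurable κ) (hX : ∀ t, Measurable (X t))
    (T : ℕ) : Measurable (crossingRate G κ X T) := by
  classical
  refine Measurable.div_const ?_ _
  simp only [crossings, Finset.card_filter, Nat.cast_sum]
  refine Finset.measurable_sum _ fun t _ => ?_
  refine measurable_from_top.comp (Measurable.ite ?_ measurable_const measurable_const)
  have hX' : Measurable fun ω t => X t ω := measurable_pi_lambda _ hX
  exact (measurableSet_eq_fun (hκ.comp ((measurable_apply_parent hG t).comp hX'))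
    (hκ.comp (hX t))).compl

lemma cells_eq_sum {α : Type*} (κ : α → ℕ) (x : ℕ → α) (T : ℕ) : cells κ x T =
    ∑ t ∈ Finset.range T, if ∀ s < t, κ (x s) ≠ κ (x t) then 1 else 0 := by
  induction T with
  | zero => simp [cells]
  | succ T ih =>
    rw [Finset.sum_range_succ, ← ih, cells, cells, Finset.range_add_one, Finset.image_insert]
    split_ifs with h
    · rw [Finset.card_insert_of_notMem]
      simpa using h
    · rw [Finset.insert_eq_of_mem, add_zero]
      push Not at h
      simpa using h

omit [MeasurableEq α] in
lemma measurable_cells {κ : α → ℕ} (hκ : Measurable κ) (hX : ∀ t, Measurable (X t)) (T : ℕ) :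
    Measurable fun ω => cells κ (fun t => X t ω) T := by
  simp only [cells_eq_sum]
  refine Finset.measurable_sum _ fun t _ => Measurable.ite (Measurable.setOf ?_)
    measurable_const measurable_const
  refine .forall fun s => measurable_const.imp (Measurable.not (measurableSet_setOfPred.1 ?_))
  exact measurableSet_eq_fun (hκ.comp (hX s)) (hκ.comp (hX t))

omit [MeasurableEq α] in
lemma measurable_cellRate {κ : α → ℕ} (hκ : Measurable κ) (hX : ∀ t, Measurable (X t)) (T : ℕ) :
    Measurable (cellRate κ X T) :=
  Measurable.div_const (measurable_from_top.comp (measurable_cells hκ hX T)) _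

/-- Finitely many terms are separated by a fixed number of digits, with high probability. -/
lemma exists_separating [MeasurableSingletonClass α]
    (hG : MeasurableSpace.generateFrom (Set.range G) = ‹MeasurableSpace α›)
    (hX : ∀ t, Measurable (X t)) (n : ℕ) {ε : ℝ≥0∞} (hε : 0 < ε) :
    ∃ (j : ℕ) (E : Set Ω), MeasurableSet E ∧ P E ≤ ε ∧ ∀ ω ∉ E, ∀ s ≤ n, ∀ t ≤ n,
      code G j (X s ω) = code G j (X t ω) → X s ω = X t ω := by
  have hGm : ∀ k, MeasurableSet (G k) := fun k => by
    rw [← hG]; exact MeasurableSpace.measurableSet_generateFrom (Set.mem_range_self k)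
  -- The failure events decrease to the empty set because all digits together separate points;
  -- continuity from above concludes.
  let B : ℕ → Set Ω := fun j => {ω | ∀ s ≤ n, ∀ t ≤ n,
    code G j (X s ω) = code G j (X t ω) → X s ω = X t ω}ᶜ
  have hB : ∀ j, MeasurableSet (B j) := fun j => by
    refine MeasurableSet.compl (Measurable.setOf ?_)
    refine .forall fun s => measurable_const.imp (.forall fun t => measurable_const.imp (.imp ?_ ?_))
    · exact measurableSet_setOfPred.1 (measurableSet_eq_fun ((measurable_code hGm j).comp (hX s))
        ((measurable_code hGm j).comp (hX t)))
    · exact measurableSet_setOfPred.1 (measurableSet_eq_fun (hX s) (hX t))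
  have hanti : Antitone B := fun j k hjk => Set.compl_subset_compl.2 fun ω h s hs t ht hc =>
    h s hs t ht (code_eq_of_le hjk hc)
  have hempty : ⋂ j, B j = ∅ := by
    refine Set.eq_empty_of_forall_notMem fun ω hω => ?_
    have hev : ∀ᶠ j in atTop, ∀ s ∈ Finset.range (n + 1), ∀ t ∈ Finset.range (n + 1),
        code G j (X s ω) = code G j (X t ω) → X s ω = X t ω := by
      refine (Finset.eventually_all _).2 fun s _ => (Finset.eventually_all _).2 fun t _ => ?_
      by_cases hst : X s ω = X t ω
      · exact .of_forall fun _ _ => hst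
      · have : ∃ j, code G j (X s ω) ≠ code G j (X t ω) := by
          by_contra! h
          exact hst (eq_of_forall_code_eq hG h)
        obtain ⟨j, hj⟩ := this
        filter_upwards [eventually_ge_atTop j] with k hk hc
        exact (hj (code_eq_of_le hk hc)).elim
    obtain ⟨j, hj⟩ := hev.exists
    exact Set.mem_iInter.1 hω j fun s hs t ht =>
      hj s (Finset.mem_range.2 (by omega)) t (Finset.mem_range.2 (by omega))
  have hlim := tendsto_measure_iInter_atTop (μ := P) (fun j => (hB j).nullMeasurableSet) hanti
    ⟨0, measure_ne_top P _⟩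
  rw [hempty, measure_empty] at hlim
  obtain ⟨j, hj⟩ := (ENNReal.tendsto_nhds_zero.1 hlim ε hε).exists
  exact ⟨j, B j, hB j, hj, fun ω hω => not_not.1 hω⟩

/-- If the crossings of all the classes of a countable partition but one are negligible, then so
are the crossings of the partition. -/
lemma negl_crossingRate_of_classes [MeasurableSingletonClass α]
    (hG : MeasurableSpace.generateFrom (Set.range G) = ‹MeasurableSpace α›)
    (hq : IsMode P q) (hX : ∀ t, Measurable (X t))
    (hV : ∀ κ : α → ℕ, Measurable κ → Negl q (cellRate κ X)) {κ : α → ℕ} (hκ : Measurable κ)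
    (hcl : ∀ i ≠ 0, Negl q (crossingRate G (fun y => κ y = i) X)) :
    Negl q (crossingRate G κ X) := by
  have hGm : ∀ k, MeasurableSet (G k) := fun k => by
    rw [← hG]; exact MeasurableSpace.measurableSet_generateFrom (Set.mem_range_self k)
  intro ε hε
  -- Five terms share `ε`: the settled classes, the failures of separation, and three copies of the
  -- cell rate.
  have hε' : 0 < ε / 5 := ENNReal.div_pos hε.ne' (by norm_num)
  obtain ⟨e, he, hesum⟩ := ENNReal.exists_pos_sum_of_countable hε'.ne' ℕ
  have hτ : ∀ i, ∃ n, i ≠ 0 →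
      q (fun T ω => if n ≤ T then crossingRate G (fun y => κ y = i) X T ω else 0) ≤ e i := by
    intro i
    by_cases hi : i = 0
    · exact ⟨0, fun h => (h hi).elim⟩
    · obtain ⟨n, hn⟩ := hcl i hi (e i) (by exact_mod_cast he i)
      exact ⟨n, fun _ => hn⟩
  choose τ hτ using hτ
  choose j E hE hPE hsep using fun i => exists_separating (P := P) hG hX (τ i)
    (ε := e i) (by exact_mod_cast he i)
  -- Each class is subdivided by its own number of digits. This partition does not depend on `T`, so
  -- the visit hypothesis applies to it.
  let κ' : α → ℕ := fun y => Nat.pair (κ y) (code G (j (κ y)) y)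
  have hκ' : Measurable κ' := by
    have h1 : Measurable fun p : ℕ × α => code G (j p.1) p.2 :=
      measurable_from_prod_countable_right fun i => measurable_code hGm (j i)
    have h2 : Measurable fun p : ℕ × ℕ => Nat.pair p.1 p.2 := .of_discrete
    exact h2.comp (hκ.prodMk (h1.comp (hκ.prodMk measurable_id)))
  obtain ⟨n, hn⟩ := hV κ' hκ' (ε / 5) hε'
  let a : ℕ → ℕ → Ω → ℝ≥0∞ := fun i T ω =>
    if i ≠ 0 ∧ τ i ≤ T then crossingRate G (fun y => κ y = i) X T ω else 0
  let b : ℕ → ℕ → Ω → ℝ≥0∞ := fun i _ => (E i).indicator 1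
  let v : ℕ → Ω → ℝ≥0∞ := fun T ω => if n ≤ T then cellRate κ' X T ω else 0
  have ha : ∀ i T, Measurable (a i T) := by
    intro i T
    by_cases h : i ≠ 0 ∧ τ i ≤ T
    · simp only [a, if_pos h]
      exact measurable_crossingRate hGm (hκ.eq_const i) hX T
    · simp only [a, if_neg h]
      exact measurable_const
  have hb : ∀ i T, Measurable (b i T) := fun i T => measurable_one.indicator (hE i)
  have hv : ∀ T, Measurable (v T) := by
    intro T
    by_cases h : n ≤ T
    · simp only [v, if_pos h]
      exact measurable_cellRate hκ' hX T
    · simp only [v, if_neg h]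
      exact measurable_const
  have hqa : ∀ i, q (a i) ≤ e i := by
    intro i
    by_cases hi : i = 0
    · refine le_trans (hq.mono (W := fun _ _ => 0) fun T ω => ?_) ((hq.const_le 0).trans bot_le)
      simp [a, hi]
    · simpa [a, hi] using hτ i hi
  have hqb : ∀ i, q (b i) ≤ e i := fun i => (hq.indicator_le (hE i)).trans (hPE i)
  have hA : q (fun T ω => ∑' i, a i T ω) ≤ ε / 5 :=
    ((hq.tsum_le a ha).trans (ENNReal.tsum_le_tsum hqa)).trans hesum.le
  have hB : q (fun T ω => ∑' i, b i T ω) ≤ ε / 5 :=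
    ((hq.tsum_le b hb).trans (ENNReal.tsum_le_tsum hqb)).trans hesum.le
  have hAm : ∀ T, Measurable fun ω => ∑' i, a i T ω := fun T => .tsum fun i => ha i T
  have hBm : ∀ T, Measurable fun ω => ∑' i, b i T ω := fun T => .tsum fun i => hb i T
  have hpt : ∀ T ω, (if n ≤ T then crossingRate G κ X T ω else 0) ≤
      (∑' i, a i T ω + ∑' i, b i T ω) + (v T ω + (v T ω + v T ω)) := by
    intro T ω
    split_ifs with hT
    swap
    · exact bot_le
    -- If separation fails for some class, the trivial bound `1` on the rate is paid by the
    -- indicator of that failure.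
    by_cases hbad : ∃ i, ω ∈ E i
    · obtain ⟨i, hi⟩ := hbad
      calc crossingRate G κ X T ω ≤ 1 := crossingRate_le_one _ _ _ _ _
        _ = b i T ω := by simp [b, hi]
        _ ≤ ∑' i, b i T ω := ENNReal.le_tsum i
        _ ≤ _ := le_add_self.trans le_self_add
    · have hgood := not_exists.1 hbad
      obtain ⟨F, hF, hle⟩ := card_crossings_le_sum (G := G) (x := fun t => X t ω) (κ := κ)
        (fun i => hsep i ω (hgood i)) T
      calc crossingRate G κ X T ω
          ≤ (((∑ i ∈ F, (crossings G (fun y => κ y = i) (fun t => X t ω) T).card +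
              3 * cells κ' (fun t => X t ω) T : ℕ)) : ℝ≥0∞) / (T : ℝ≥0∞) :=
            ENNReal.div_le_div_right (by exact_mod_cast hle) _
        _ = ∑ i ∈ F, a i T ω + 3 * v T ω := by
            push_cast
            rw [ENNReal.add_div, div_eq_mul_inv (Finset.sum _ _), Finset.sum_mul]
            congr 1
            · exact Finset.sum_congr rfl fun i hi => by
                simp [a, hF i hi, crossingRate, div_eq_mul_inv]
            · simp only [v, if_pos hT, cellRate, mul_div_assoc]
        _ ≤ ∑' i, a i T ω + 3 * v T ω := by gcongr; exact ENNReal.sum_le_tsum F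
        _ ≤ _ := add_le_add le_self_add (le_of_eq (by ring))
  refine ⟨n, (hq.mono hpt).trans ?_⟩
  calc _ ≤ (ε / 5 + ε / 5) + (ε / 5 + (ε / 5 + ε / 5)) := by
        refine (hq.add_le (fun T => (hAm T).add (hBm T))
          (fun T => (hv T).add ((hv T).add (hv T)))).trans (add_le_add ?_ ?_)
        · exact (hq.add_le hAm hBm).trans (add_le_add hA hB)
        · refine (hq.add_le hv fun T => (hv T).add (hv T)).trans (add_le_add hn ?_)
          exact (hq.add_le hv hv).trans (add_le_add hn hn)
    _ = 5 * (ε / 5) := by ring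
    _ = ε := ENNReal.mul_div_cancel (by norm_num) (by norm_num)

-- The shift reserves label `0` for points outside all the sets, the one class on which
-- `negl_crossingRate_of_classes` imposes no condition.
omit [MeasurableEq α] in
lemma exists_index {f : ℕ → Set α} (hd : Pairwise (Function.onFun Disjoint f))
    (hf : ∀ i, MeasurableSet (f i)) :
    ∃ κ : α → ℕ, Measurable κ ∧ ∀ i x, κ x = i + 1 ↔ x ∈ f i := by
  classical
  let κ : α → ℕ := fun x => if h : ∃ i, x ∈ f i then Nat.find h + 1 else 0
  have hκ : ∀ i x, κ x = i + 1 ↔ x ∈ f i := by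
    intro i x
    by_cases h : ∃ i, x ∈ f i
    · simp only [κ, dif_pos h, Nat.add_right_cancel_iff]
      constructor
      · rintro rfl
        exact Nat.find_spec h
      · intro hi
        by_contra hne
        exact Set.disjoint_left.1 (hd hne) (Nat.find_spec h) hi
    · simp only [κ, dif_neg h]
      exact ⟨fun h0 => absurd h0 (Nat.succ_ne_zero i).symm, fun hi => (h ⟨i, hi⟩).elim⟩
  refine ⟨κ, ?_, hκ⟩
  have hs : ∀ i, MeasurableSet (κ ⁻¹' {i + 1}) := fun i => by
    have : κ ⁻¹' {i + 1} = f i := Set.ext fun x => hκ i x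
    rw [this]
    exact hf i
  refine measurable_to_countable' fun i => ?_
  cases i with
  | succ i => exact hs i
  | zero =>
    have : κ ⁻¹' {0} = (⋃ i, κ ⁻¹' {i + 1})ᶜ := by
      ext x
      simp only [Set.mem_preimage, Set.mem_singleton_iff, Set.mem_compl_iff, Set.mem_iUnion,
        not_exists]
      exact ⟨fun h i => by omega, fun h => by_contra fun h0 =>
        h (κ x - 1) (by omega)⟩
    rw [this]
    exact (MeasurableSet.iUnion hs).compl

lemma crossingRate_le_of_imp {Ω α β γ : Type*} {G : ℕ → Set α} {κ : α → β} {κ' : α → γ}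
    {X : ℕ → Ω → α} (h : ∀ x y, κ' x = κ' y → κ x = κ y) (T : ℕ) (ω : Ω) :
    crossingRate G κ X T ω ≤ crossingRate G κ' X T ω := by
  refine ENNReal.div_le_div_right (Nat.cast_le.2 (Finset.card_le_card fun t ht => ?_)) _
  rw [mem_crossings] at ht ⊢
  exact ⟨ht.1, fun he => ht.2 (h _ _ he)⟩

/-- For every measurable set, the times at which exactly one of a point and its representative
belongs to the set are negligible. -/
lemma negl_crossingRate_mem [MeasurableSingletonClass α]
    (hG : MeasurableSpace.generateFrom (Set.range G) = ‹MeasurableSpace α›)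
    (hq : IsMode P q) (hX : ∀ t, Measurable (X t))
    (hV : ∀ κ : α → ℕ, Measurable κ → Negl q (cellRate κ X)) {A : Set α} (hA : MeasurableSet A) :
    Negl q (crossingRate G (fun y => y ∈ A) X) := by
  induction A, hA using MeasurableSpace.induction_on_inter
    (hG.symm.trans (generateFrom_code G).symm) (isPiSystem_code G) with
  | empty =>
    refine (negl_const_div hq 0).mono hq fun T ω => ?_
    simp [crossingRate, crossings]
  | basic A hA =>
    obtain ⟨j, U, rfl⟩ := hA
    refine (negl_const_div hq ((j + 1) * 2 ^ j)).mono hq fun T ω => ?_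
    refine ENNReal.div_le_div_right (Nat.cast_le.2 ?_) _
    exact card_crossings_code_le (G := G) (x := fun t => X t ω) fun m => m ∈ U
  | compl A hA ih =>
    exact ih.mono hq fun T ω => crossingRate_le_of_imp
      (fun x y h => by simp only [Set.mem_compl_iff, h]) T ω
  | iUnion f hd hf ih =>
    obtain ⟨κ, hκ, hκf⟩ := exists_index hd hf
    have hcl : ∀ i ≠ 0, Negl q (crossingRate G (fun y => κ y = i) X) := by
      intro i hi
      obtain ⟨i, rfl⟩ := Nat.exists_eq_succ_of_ne_zero hi
      have : (fun y => κ y = i.succ) = fun y => y ∈ f i := funext fun y => propext (hκf i y)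
      rw [this]
      exact ih i
    refine (negl_crossingRate_of_classes hG hq hX hV hκ hcl).mono hq fun T ω =>
      crossingRate_le_of_imp (fun x y h => ?_) T ω
    simp only [Set.mem_iUnion, ← hκf, h]

/-- Every class is now known to have negligible crossings, so the partition argument applies once
more. -/
lemma negl_crossingRate [MeasurableSingletonClass α]
    (hG : MeasurableSpace.generateFrom (Set.range G) = ‹MeasurableSpace α›)
    (hq : IsMode P q) (hX : ∀ t, Measurable (X t))
    (hV : ∀ κ : α → ℕ, Measurable κ → Negl q (cellRate κ X)) {κ : α → ℕ} (hκ : Measurable κ) :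
    Negl q (crossingRate G κ X) :=
  negl_crossingRate_of_classes hG hq hX hV hκ fun i _ =>
    negl_crossingRate_mem hG hq hX hV (hκ (measurableSet_singleton i))

end Sufficiency

/-! ### The weak and strong modes. -/

section Modes
variable {Ω : Type*} [MeasurableSpace Ω] {P : Measure Ω} {Z : ℕ → Ω → ℝ≥0∞}

/-- The supremum of the expectations. -/
noncomputable def weakMode (P : Measure Ω) (Z : ℕ → Ω → ℝ≥0∞) : ℝ≥0∞ := ⨆ T, ∫⁻ ω, Z T ω ∂P

/-- The expectation of the supremum. -/
noncomputable def strongMode (P : Measure Ω) (Z : ℕ → Ω → ℝ≥0∞) : ℝ≥0∞ := ∫⁻ ω, ⨆ T, Z T ω ∂P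

lemma isMode_weakMode [IsProbabilityMeasure P] : IsMode P (weakMode P) where
  mono h := iSup_mono fun T => lintegral_mono (h T)
  tsum_le Z hZ := iSup_le fun T => by
    rw [lintegral_tsum fun i => (hZ i T).aemeasurable]
    exact ENNReal.tsum_le_tsum fun i => le_iSup (fun T => ∫⁻ ω, Z i T ω ∂P) T
  indicator_le hE := iSup_le fun _ => (lintegral_indicator_one hE).le
  const_le c := iSup_le fun _ => by simp

lemma isMode_strongMode [IsProbabilityMeasure P] : IsMode P (strongMode P) where
  mono h := lintegral_mono fun ω => iSup_mono fun T => h T ω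
  tsum_le Z hZ := by
    refine le_trans (lintegral_mono fun ω => ?_)
      (lintegral_tsum fun i => (Measurable.iSup (hZ i)).aemeasurable).le
    exact iSup_le fun T => ENNReal.tsum_le_tsum fun i => by
      simpa using le_iSup (fun T => Z i T ω) T
  indicator_le hE := by
    simp only [strongMode, ciSup_const]
    exact (lintegral_indicator_one hE).le
  const_le c := by simp [strongMode]

lemma negl_weakMode_iff :
    Negl (weakMode P) Z ↔ Tendsto (fun T => ∫⁻ ω, Z T ω ∂P) atTop (𝓝 0) := by
  rw [ENNReal.tendsto_nhds_zero]
  refine forall₂_congr fun ε _ => ?_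
  rw [eventually_atTop]
  refine exists_congr fun n => ?_
  rw [weakMode, iSup_le_iff]
  refine forall_congr' fun T => ?_
  by_cases h : n ≤ T <;> simp [h]

/-- Convergence to `0` means that the tail suprema decrease to `0`. As these are at most `1`, almost
sure convergence is equivalent to convergence of their expectations. -/
lemma negl_strongMode_iff [IsProbabilityMeasure P] (hZ : ∀ T, Measurable (Z T))
    (h1 : ∀ T ω, Z T ω ≤ 1) :
    Negl (strongMode P) Z ↔ ∀ᵐ ω ∂P, Tendsto (fun T => Z T ω) atTop (𝓝 0) := by
  let F : ℕ → Ω → ℝ≥0∞ := fun n ω => ⨆ T, if n ≤ T then Z T ω else 0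
  have hF : ∀ n, Measurable (F n) := fun n => Measurable.iSup fun T => by
    by_cases h : n ≤ T
    · simpa [h] using hZ T
    · simp [h]
  have hZF : ∀ {n T : ℕ} (ω), n ≤ T → Z T ω ≤ F n ω := fun {n T} ω h => by
    simpa [h] using le_iSup (fun T => if n ≤ T then Z T ω else 0) T
  constructor
  · intro h
    have h0 : ∫⁻ ω, ⨅ n, F n ω ∂P = 0 := by
      refine le_antisymm (le_of_forall_gt_imp_ge_of_dense fun ε hε => ?_) bot_le
      obtain ⟨n, hn⟩ := h ε hε
      exact (lintegral_mono fun ω => iInf_le _ n).trans hn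
    rw [lintegral_eq_zero_iff (Measurable.iInf hF)] at h0
    filter_upwards [h0] with ω hω
    refine ENNReal.tendsto_nhds_zero.2 fun ε hε => ?_
    have hω' : ⨅ n, F n ω < ε := lt_of_le_of_lt (le_of_eq hω) hε
    obtain ⟨n, hn⟩ := iInf_lt_iff.1 hω'
    filter_upwards [eventually_ge_atTop n] with T hT
    exact (hZF ω hT).trans hn.le
  · intro h
    have hlim : Tendsto (fun n => ∫⁻ ω, F n ω ∂P) atTop (𝓝 (∫⁻ _, 0 ∂P)) := by
      refine tendsto_lintegral_of_dominated_convergence (fun _ => 1) hF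
        (fun n => .of_forall fun ω => iSup_le fun T => ?_) (by simp) ?_
      · split_ifs
        · exact h1 T ω
        · exact bot_le
      · filter_upwards [h] with ω hω
        refine ENNReal.tendsto_nhds_zero.2 fun ε hε => ?_
        obtain ⟨n, hn⟩ := eventually_atTop.1 (ENNReal.tendsto_nhds_zero.1 hω ε hε)
        filter_upwards [eventually_ge_atTop n] with m hm
        refine iSup_le fun T => ?_
        split_ifs with hT
        · exact hn T (hm.trans hT)
        · exact bot_le
    rw [lintegral_zero] at hlim
    intro ε hε
    exact (ENNReal.tendsto_nhds_zero.1 hlim ε hε).exists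

end Modes

lemma isLittleO_natCast_iff {b : ℕ → ℝ≥0∞} (hb : ∀ T : ℕ, b T ≤ T) :
    (fun T => (b T).toReal) =o[atTop] (fun T : ℕ => (T : ℝ)) ↔
      Tendsto (fun T : ℕ => b T / (T : ℝ≥0∞)) atTop (𝓝 0) := by
  rw [isLittleO_iff_tendsto' (by
    filter_upwards [eventually_gt_atTop 0] with T hT h
    exact absurd h (by positivity))]
  have hne : ∀ T : ℕ, b T / (T : ℝ≥0∞) ≠ ∞ := fun T =>
    ((ENNReal.div_le_of_le_mul (by simpa using hb T)).trans_lt ENNReal.one_lt_top).ne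
  rw [← ENNReal.tendsto_toReal_iff hne ENNReal.zero_ne_top]
  simp [ENNReal.toReal_div]

/-! ### Partitions as labellings by natural numbers. -/

section Visits
variable {Ω α : Type*} [MeasurableSpace Ω] {P : Measure Ω} [MeasurableSpace α]
  {X : ℕ → Ω → α}

lemma isMeasurablePartition_preimage {κ : α → ℕ} (hκ : Measurable κ) :
    IsMeasurablePartition fun k => κ ⁻¹' {k} where
  measurableSet k := hκ (measurableSet_singleton k)
  disjoint _ _ h := Disjoint.preimage κ (Set.disjoint_singleton.2 h)
  iUnion_eq := by ext; simp

lemma IsMeasurablePartition.exists_preimage {A : ℕ → Set α} (hA : IsMeasurablePartition A) :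
    ∃ κ : α → ℕ, Measurable κ ∧ A = fun k => κ ⁻¹' {k} := by
  obtain ⟨κ, hκ, h⟩ := exists_index hA.disjoint hA.measurableSet
  -- The cells cover the space, so label `0` is not used and the shift can be undone.
  refine ⟨fun x => κ x - 1, (Measurable.of_discrete (f := fun n : ℕ => n - 1)).comp hκ, ?_⟩
  ext k x
  obtain ⟨i, hi⟩ := Set.mem_iUnion.1 (hA.iUnion_eq.ge (Set.mem_univ x))
  have := (h i x).2 hi
  rw [← h]
  simp only [Set.mem_preimage, Set.mem_singleton_iff]
  omega

omit [MeasurableSpace Ω] [MeasurableSpace α] in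
lemma visits_preimage (κ : α → ℕ) (T : ℕ) (ω : Ω) :
    visits (fun k => κ ⁻¹' {k}) X T ω = cells κ (fun t => X t ω) T := by
  rw [visits, cells, ← Set.ncard_coe_finset]
  congr 1
  ext k
  simp

lemma forall_partition_iff {p : (ℕ → Set α) → Prop} :
    (∀ A, IsMeasurablePartition A → p A) ↔
      ∀ κ : α → ℕ, Measurable κ → p fun k => κ ⁻¹' {k} := by
  refine ⟨fun h κ hκ => h _ (isMeasurablePartition_preimage hκ), fun h A hA => ?_⟩
  obtain ⟨κ, hκ, rfl⟩ := hA.exists_preimage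
  exact h κ hκ

lemma mem_SMV_iff : X ∈ SMV P ↔ (∀ t, Measurable (X t)) ∧ ∀ κ : α → ℕ, Measurable κ →
    ∀ᵐ ω ∂P, Tendsto (fun T => cellRate κ X T ω) atTop (𝓝 0) := by
  refine and_congr_right fun hX => forall_partition_iff.trans <| forall₂_congr fun κ hκ =>
    eventually_congr (.of_forall fun ω => ?_)
  have := isLittleO_natCast_iff (b := fun T => (cells κ (fun t => X t ω) T : ℝ≥0∞))
    (fun T => by exact_mod_cast cells_le _ _ _)
  simpa only [visits_preimage, ENNReal.toReal_natCast, cellRate] using this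

lemma mem_WSMV_iff [IsProbabilityMeasure P] : X ∈ WSMV P ↔ (∀ t, Measurable (X t)) ∧
    ∀ κ : α → ℕ, Measurable κ → Tendsto (fun T => ∫⁻ ω, cellRate κ X T ω ∂P) atTop (𝓝 0) := by
  refine and_congr_right fun hX => forall_partition_iff.trans <| forall₂_congr fun κ hκ => ?_
  have hm : ∀ T, Measurable fun ω => (cells κ (fun t => X t ω) T : ℝ≥0∞) := fun T =>
    measurable_from_top.comp (measurable_cells hκ hX T)
  have hle : ∀ T : ℕ, ∫⁻ ω, (cells κ (fun t => X t ω) T : ℝ≥0∞) ∂P ≤ T := fun T =>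
    (lintegral_mono (g := fun _ => (T : ℝ≥0∞)) fun ω =>
      Nat.cast_le.2 (cells_le κ (fun t => X t ω) T)).trans (by simp)
  have h1 : ∀ T, ∫ ω, (visits (fun k => κ ⁻¹' {k}) X T ω : ℝ) ∂P =
      (∫⁻ ω, (cells κ (fun t => X t ω) T : ℝ≥0∞) ∂P).toReal := fun T => by
    rw [← integral_toReal (hm T).aemeasurable (.of_forall fun ω => ENNReal.natCast_lt_top _)]
    simp only [visits_preimage, ENNReal.toReal_natCast]
  have h2 : ∀ T, ∫⁻ ω, cellRate κ X T ω ∂P =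
      (∫⁻ ω, (cells κ (fun t => X t ω) T : ℝ≥0∞) ∂P) / (T : ℝ≥0∞) := fun T => by
    simp only [cellRate, div_eq_mul_inv]
    exact lintegral_mul_const _ (hm T)
  simp only [h1, h2]
  exact isLittleO_natCast_iff hle

end Visits

/-! ### Near-metric spaces and quantization of targets. -/

section NearMetric
variable {𝒴 : Type*} {ℓ : 𝒴 → 𝒴 → ℝ≥0}

lemma IsNearMetric.exists_pos_const (hℓ : IsNearMetric ℓ) :
    ∃ c : ℝ≥0, 0 < c ∧ ∀ y₁ y₂ y₃, ℓ y₁ y₃ ≤ c * (ℓ y₂ y₁ + ℓ y₂ y₃) := by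
  obtain ⟨c, hc⟩ := hℓ.relaxed_triangle
  refine ⟨c + 1, by positivity, fun y₁ y₂ y₃ => (hc y₁ y₂ y₃).trans ?_⟩
  gcongr
  exact le_self_add

/-- Around each point there is a measurable set between two balls, whose radii do not depend on the
point. -/
lemma IsNearMetric.exists_measurableSet_between (hℓ : IsNearMetric ℓ) {ε : ℝ≥0} (hε : 0 < ε) :
    ∃ δ : ℝ≥0, 0 < δ ∧ ∀ z, ∃ O : Set 𝒴, MeasurableSet[lossBorel ℓ] O ∧
      (∀ y, ℓ z y < δ → y ∈ O) ∧ ∀ y ∈ O, ℓ z y < ε := by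
  obtain ⟨c, hc, htri⟩ := hℓ.exists_pos_const
  have key : ∀ {η : ℝ≥0}, ∀ {w w' z}, ℓ w w' < η / (2 * c) → ℓ w' z < η / (2 * c) →
      ℓ w z < η := by
    intro η w w' z h1 h2
    rw [hℓ.symm] at h1
    calc ℓ w z ≤ c * (ℓ w' w + ℓ w' z) := htri w w' z
      _ < c * (η / (2 * c) + η / (2 * c)) := by gcongr
      _ = η := by field_simp; norm_num
  have hdiv : ∀ {η : ℝ≥0}, 0 < η → 0 < η / (2 * c) := fun hη => by positivity
  -- Balls of a near-metric need not be open. The points around which some ball stays inside the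
  -- `ε`-ball form an open set, by the relaxed triangle inequality.
  refine ⟨ε / (2 * c), hdiv hε, fun z => ⟨{w | ∃ η : ℝ≥0, 0 < η ∧ ∀ y, ℓ w y < η → ℓ z y < ε},
    ?_, ?_, ?_⟩⟩
  · refine MeasurableSpace.measurableSet_generateFrom ?_
    rintro w ⟨η, hη, hw⟩
    exact ⟨η / (2 * c), hdiv hη, fun w' hw' => ⟨η / (2 * c), hdiv hη, fun y hy =>
      hw y (key hw' hy)⟩⟩
  · exact fun w hw => ⟨ε / (2 * c), hdiv hε, fun y hy => key hw hy⟩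
  · rintro w ⟨η, hη, hw⟩
    exact hw w (by rwa [(hℓ.eq_zero_iff w w).2 rfl])

/-- Every measurable function is approximated uniformly by functions of a countable measurable
partition. -/
lemma IsNearMetric.exists_quantizer [MeasurableSpace 𝒴] (hℓ : IsNearMetric ℓ)
    (hsep : IsSeparableLoss ℓ) (h𝒴 : lossBorel ℓ ≤ ‹MeasurableSpace 𝒴›) {α : Type*}
    [MeasurableSpace α] {f : α → 𝒴} (hf : Measurable f) {ε : ℝ≥0} (hε : 0 < ε) :
    ∃ κ : α → ℕ, Measurable κ ∧ ∀ x y, κ x = κ y → ℓ (f x) (f y) ≤ ε := by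
  obtain ⟨s, hs, hdense⟩ := hsep
  obtain ⟨c, hc, htri⟩ := hℓ.exists_pos_const
  rcases isEmpty_or_nonempty 𝒴 with hy | ⟨⟨y₀⟩⟩
  · exact ⟨fun _ => 0, measurable_const, fun x => (hy.false (f x)).elim⟩
  obtain ⟨z₀, hz₀, -⟩ := hdense y₀ 1 one_pos
  obtain ⟨z, rfl⟩ := hs.exists_eq_range ⟨z₀, hz₀⟩
  obtain ⟨δ, hδ, hO⟩ := hℓ.exists_measurableSet_between (ε := ε / (2 * c)) (by positivity)
  choose O hOm hδO hOε using fun i => hO (z i)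
  obtain ⟨κ, hκ, hκf⟩ := exists_index (f := fun i => f ⁻¹' disjointed O i)
    (fun i j hij => (disjoint_disjointed O hij).preimage f)
    (fun i => hf (MeasurableSet.disjointed (fun i => h𝒴 _ (hOm i)) i))
  have hex : ∀ x, ∃ i, κ x = i + 1 := by
    intro x
    have : f x ∈ ⋃ i, disjointed O i := by
      rw [iUnion_disjointed]
      obtain ⟨-, ⟨i, rfl⟩, hi⟩ := hdense (f x) δ hδ
      exact Set.mem_iUnion.2 ⟨i, hδO i _ hi⟩
    obtain ⟨i, hi⟩ := Set.mem_iUnion.1 this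
    exact ⟨i, (hκf i x).2 hi⟩
  refine ⟨κ, hκ, fun x y hxy => ?_⟩
  obtain ⟨i, hi⟩ := hex x
  have hx := hOε i _ (disjointed_subset O i ((hκf i x).1 hi))
  have hy := hOε i _ (disjointed_subset O i ((hκf i y).1 (hxy ▸ hi)))
  calc ℓ (f x) (f y) ≤ c * (ℓ (z i) (f x) + ℓ (z i) (f y)) := htri _ _ _
    _ ≤ c * (ε / (2 * c) + ε / (2 * c)) := by gcongr
    _ = ε := by field_simp; norm_num

lemma coe_le_supLoss (ℓ : 𝒴 → 𝒴 → ℝ≥0) (y₁ y₂ : 𝒴) : (ℓ y₁ y₂ : ℝ≥0∞) ≤ supLoss ℓ :=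
  le_iSup₂ (f := fun y₁ y₂ => (ℓ y₁ y₂ : ℝ≥0∞)) y₁ y₂

end NearMetric

/-! ### Consistency of the tree rule. -/

section Consistency
variable {Ω 𝒳 𝒴 : Type*} [MeasurableSpace Ω] {P : Measure Ω} [IsProbabilityMeasure P]
  [MeasurableSpace 𝒳] [MeasurableEq 𝒳] [MeasurableSpace 𝒴] {ℓ : 𝒴 → 𝒴 → ℝ≥0}
  {X : ℕ → Ω → 𝒳} {G : ℕ → Set 𝒳} {fstar : 𝒳 → 𝒴} {y₀ : 𝒴}

omit [MeasurableSpace Ω] [MeasurableEq 𝒳] in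
lemma coe_avgLoss (f : LearningRule 𝒳 𝒴) (T : ℕ) (ω : Ω) :
    (avgLoss ℓ X f fstar T ω : ℝ≥0∞) = (∑ t ∈ Finset.range T,
      (ℓ (prediction X f fstar t ω) (fstar (X t ω)) : ℝ≥0∞)) / (T : ℝ≥0∞) := by
  rcases Nat.eq_zero_or_pos T with rfl | hT
  · simp [avgLoss]
  · have : (T : ℝ≥0) ≠ 0 := by positivity
    rw [avgLoss, one_div, ENNReal.coe_mul, ENNReal.coe_inv this, ENNReal.coe_natCast,
      ENNReal.ofNNReal_finsetSum, mul_comm, div_eq_mul_inv]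

/-- If `κ` determines the target up to `ε`, only the crossings of `κ` and the first prediction
contribute more than `ε` to the loss. -/
lemma avgLoss_treeRule_le (hG : ∀ k, MeasurableSet (G k)) {κ : 𝒳 → ℕ} {ε : ℝ≥0}
    (hκ : ∀ x y, κ x = κ y → ℓ (fstar x) (fstar y) ≤ ε) (T : ℕ) (ω : Ω) :
    (avgLoss ℓ X (treeRule hG y₀) fstar T ω : ℝ≥0∞) ≤
      ε + supLoss ℓ * crossingRate G κ X T ω + supLoss ℓ / (T : ℝ≥0∞) := by
  rcases Nat.eq_zero_or_pos T with rfl | hT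
  · simp [coe_avgLoss]
  have hT0 : (T : ℝ≥0∞) ≠ 0 := by exact_mod_cast hT.ne'
  set C := crossings G κ (fun t => X t ω) T with hC
  have hpt : ∀ t ∈ Finset.range T,
      (ℓ (prediction X (treeRule hG y₀) fstar t ω) (fstar (X t ω)) : ℝ≥0∞) ≤
        ε + (if t ∈ C then supLoss ℓ else 0) + if t = 0 then supLoss ℓ else 0 := by
    intro t ht
    rcases Nat.eq_zero_or_pos t with rfl | h0
    · rw [if_pos rfl]
      exact (coe_le_supLoss ℓ _ _).trans le_add_self
    · refine le_trans ?_ le_self_add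
      by_cases h : t ∈ C
      · rw [if_pos h]
        exact (coe_le_supLoss ℓ _ _).trans le_add_self
      · refine le_trans ?_ le_self_add
        rw [hC, mem_crossings] at h
        push Not at h
        rw [prediction_treeRule hG y₀ X fstar h0]
        exact_mod_cast hκ _ _ (h (Finset.mem_range.1 ht))
  have hsub : {t ∈ Finset.range T | t ∈ C} = C := by
    ext t
    simp only [Finset.mem_filter, Finset.mem_range, and_iff_right_iff_imp]
    exact fun h => (mem_crossings.1 h).1
  calc (avgLoss ℓ X (treeRule hG y₀) fstar T ω : ℝ≥0∞)
      ≤ (∑ t ∈ Finset.range T, ((ε : ℝ≥0∞) + (if t ∈ C then supLoss ℓ else 0) +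
          if t = 0 then supLoss ℓ else 0)) / (T : ℝ≥0∞) := by
        rw [coe_avgLoss]
        exact ENNReal.div_le_div_right (Finset.sum_le_sum hpt) _
    _ = (T * ε + C.card * supLoss ℓ + supLoss ℓ) / (T : ℝ≥0∞) := by
        rw [Finset.sum_add_distrib, Finset.sum_add_distrib, ← Finset.sum_filter, hsub]
        simp [hT]
    _ = _ := by
        rw [ENNReal.add_div, ENNReal.add_div, crossingRate, ← hC]
        congr 2
        · rw [mul_comm, mul_div_assoc, ENNReal.div_self hT0 (ENNReal.natCast_ne_top T), mul_one]
        · rw [mul_comm, mul_div_assoc]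

/-- The precision `e n` is fixed before `T` grows; the term `L / T` accounts for the arbitrary first
prediction. -/
lemma tendsto_zero_of_forall_le {u : ℕ → ℝ≥0∞} {r : ℕ → ℕ → ℝ≥0∞} {L : ℝ≥0∞} (hL : L ≠ ∞)
    {e : ℕ → ℝ≥0} (he : Tendsto e atTop (𝓝 0))
    (h : ∀ n T, u T ≤ e n + L * r n T + L / (T : ℝ≥0∞))
    (hr : ∀ n, Tendsto (r n) atTop (𝓝 0)) : Tendsto u atTop (𝓝 0) := by
  refine ENNReal.tendsto_nhds_zero.2 fun ε hε => ?_
  have he' : Tendsto (fun n => (e n : ℝ≥0∞)) atTop (𝓝 0) := by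
    rwa [← ENNReal.coe_zero, ENNReal.tendsto_coe]
  obtain ⟨n, hn⟩ := (he'.eventually (gt_mem_nhds hε)).exists
  have hlim : Tendsto (fun T : ℕ => e n + L * r n T + L / (T : ℝ≥0∞)) atTop (𝓝 (e n)) := by
    have h1 := ENNReal.Tendsto.const_mul (hr n) (Or.inr hL)
    have h2 := ENNReal.Tendsto.const_div (a := L) ENNReal.tendsto_nat_nhds_top (Or.inr hL)
    simpa using (tendsto_const_nhds.add h1).add h2
  filter_upwards [hlim.eventually (gt_mem_nhds hn)] with T hT
  exact (h n T).trans hT.le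

variable (hℓ : IsNearMetric ℓ) (hsep : IsSeparableLoss ℓ) (hbdd : supLoss ℓ < ∞)
  (h𝒴 : lossBorel ℓ ≤ ‹MeasurableSpace 𝒴›) [MeasurableSingletonClass 𝒳]
  (hG : MeasurableSpace.generateFrom (Set.range G) = ‹MeasurableSpace 𝒳›)
  (hGm : ∀ k, MeasurableSet (G k))

include hℓ hsep hbdd h𝒴 hG

lemma stronglyConsistent_treeRule (hX : X ∈ SMV P) (hf : Measurable fstar) :
    StronglyConsistent P ℓ X (treeRule hGm y₀) fstar := by
  obtain ⟨hXm, hX⟩ := mem_SMV_iff.1 hX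
  choose κ hκ hκf using fun n : ℕ => hℓ.exists_quantizer hsep h𝒴 hf
    (ε := 1 / ((n : ℝ≥0) + 1)) (by positivity)
  have hV : ∀ κ : 𝒳 → ℕ, Measurable κ → Negl (strongMode P) (cellRate κ X) := fun κ hκ =>
    (negl_strongMode_iff (measurable_cellRate hκ hXm) (cellRate_le_one κ X)).2 (hX κ hκ)
  have hr : ∀ n, ∀ᵐ ω ∂P, Tendsto (fun T => crossingRate G (κ n) X T ω) atTop (𝓝 0) := fun n =>
    (negl_strongMode_iff (measurable_crossingRate hGm (hκ n) hXm)
      (crossingRate_le_one G (κ n) X)).1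
      (negl_crossingRate hG isMode_strongMode hXm hV (hκ n))
  filter_upwards [ae_all_iff.2 hr] with ω hω
  rw [← ENNReal.tendsto_coe, ENNReal.coe_zero]
  exact tendsto_zero_of_forall_le hbdd.ne (tendsto_one_div_add_atTop_nhds_zero_nat (𝕜 := ℝ≥0))
    (fun n T => avgLoss_treeRule_le hGm (hκf n) T ω) hω

lemma weaklyConsistent_treeRule (hX : X ∈ WSMV P) (hf : Measurable fstar) :
    WeaklyConsistent P ℓ X (treeRule hGm y₀) fstar := by
  obtain ⟨hXm, hX⟩ := mem_WSMV_iff.1 hX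
  choose κ hκ hκf using fun n : ℕ => hℓ.exists_quantizer hsep h𝒴 hf
    (ε := 1 / ((n : ℝ≥0) + 1)) (by positivity)
  have hr : ∀ n, Tendsto (fun T => ∫⁻ ω, crossingRate G (κ n) X T ω ∂P) atTop (𝓝 0) := fun n =>
    negl_weakMode_iff.1 (negl_crossingRate hG isMode_weakMode hXm
      (fun κ hκ => negl_weakMode_iff.2 (hX κ hκ)) (hκ n))
  refine tendsto_zero_of_forall_le hbdd.ne (tendsto_one_div_add_atTop_nhds_zero_nat (𝕜 := ℝ≥0))
    (fun n T => ?_) hr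
  -- The loss may be non-measurable; monotonicity of the lower integral suffices, and the upper
  -- bound is measurable.
  refine (lintegral_mono fun ω => avgLoss_treeRule_le hGm (hκf n) T ω).trans (le_of_eq ?_)
  have hm := measurable_crossingRate hGm (hκ n) hXm T
  rw [lintegral_add_right _ measurable_const, lintegral_add_left measurable_const,
    lintegral_const_mul _ hm]
  simp

end Consistency

/-! ### Random labels. -/

/-- The law of a fair coin. -/
noncomputable def coin : Measure Bool := (PMF.uniformOfFintype Bool).toMeasure

instance : IsProbabilityMeasure coin := PMF.toMeasure.isProbabilityMeasure _

lemma map_not_coin : coin.map (fun b => !b) = coin := by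
  refine Measure.ext_of_singleton fun b => ?_
  rw [Measure.map_apply .of_discrete (measurableSet_singleton b)]
  have : (fun b => !b) ⁻¹' {b} = {!b} := by
    ext a
    cases a <;> cases b <;> simp
  rw [this, coin, PMF.toMeasure_apply_singleton _ _ (measurableSet_singleton _),
    PMF.toMeasure_apply_singleton _ _ (measurableSet_singleton _)]
  simp

/-- The law of a sequence of independent fair coins. -/
noncomputable def coins : Measure (ℕ → Bool) := Measure.infinitePi fun _ => coin

instance : IsProbabilityMeasure coins := by
  unfold coins
  infer_instance

/-- Flips the coin number `k`. -/
def flip (k : ℕ) (u : ℕ → Bool) (i : ℕ) : Bool := if i = k then !u i else u i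

lemma measurePreserving_flip (k : ℕ) : MeasurePreserving (flip k) coins coins := by
  have hm : ∀ i : ℕ, Measurable fun b : Bool => if i = k then !b else b := fun i => .of_discrete
  refine ⟨measurable_pi_lambda _ fun i => (hm i).comp (measurable_pi_apply i), ?_⟩
  have := Measure.infinitePi_map_pi (μ := fun _ : ℕ => coin) hm
  rw [coins]
  refine this.trans ?_
  congr 1
  ext1 i
  by_cases h : i = k
  · simp only [h, if_true]
    exact map_not_coin
  · simp only [h, if_false]
    exact Measure.map_id

/-- An event that does not involve the coin `k` predicts this coin with probability `1 / 2`. -/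
lemma two_mul_lintegral_coins_eq_one {k : ℕ} {p : (ℕ → Bool) → Prop} [DecidablePred p]
    (hp : Measurable p) (hk : ∀ u, p (flip k u) ↔ p u) :
    2 * ∫⁻ u, (if p u ↔ u k = true then 0 else 1) ∂coins = 1 := by
  let F : (ℕ → Bool) → ℝ≥0∞ := fun u => if p u ↔ u k = true then 0 else 1
  have hF : Measurable F := Measurable.ite
    (hp.iff ((measurable_pi_apply k).eq_const true)).setOf measurable_const measurable_const
  -- Flipping coin `k` leaves the guess unchanged and reverses its correctness.
  have hsum : ∀ u, F u + F (flip k u) = 1 := by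
    intro u
    have h1 : flip k u k = !u k := by simp [flip]
    simp only [F, hk, h1]
    by_cases h : p u <;> cases u k <;> simp [h]
  calc 2 * ∫⁻ u, F u ∂coins = ∫⁻ u, F u ∂coins + ∫⁻ u, F (flip k u) ∂coins := by
        rw [(measurePreserving_flip k).lintegral_comp hF, two_mul]
    _ = 1 := by
        rw [← lintegral_add_left hF]
        simp [hsum]

/-! ### Necessity of sublinear visits. -/

section Necessity
variable {Ω 𝒳 𝒴 : Type*} [MeasurableSpace Ω] {P : Measure Ω} [IsProbabilityMeasure P]
  [MeasurableSpace 𝒳] [MeasurableSpace 𝒴] {ℓ : 𝒴 → 𝒴 → ℝ≥0} {X : ℕ → Ω → 𝒳}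
  {f : LearningRule 𝒳 𝒴} {κ : 𝒳 → ℕ} {y : Bool → 𝒴} {O : Set 𝒴}

open Classical in
/-- The frequency of the times before `T` at which membership of the prediction in `O` does not
match the label that the coins `u` give to the cell of the instance. -/
noncomputable def mistakeRate (X : ℕ → Ω → 𝒳) (f : LearningRule 𝒳 𝒴) (κ : 𝒳 → ℕ) (y : Bool → 𝒴)
    (O : Set 𝒴) (T : ℕ) (u : ℕ → Bool) (ω : Ω) : ℝ≥0∞ :=
  (∑ t ∈ Finset.range T,
    if prediction X f (fun x => y (u (κ x))) t ω ∈ O ↔ u (κ (X t ω)) = true then 0 else 1) /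
      (T : ℝ≥0∞)

omit [MeasurableSpace Ω] in
lemma mistakeRate_le_one (T : ℕ) (u : ℕ → Bool) (ω : Ω) : mistakeRate X f κ y O T u ω ≤ 1 := by
  refine ENNReal.div_le_of_le_mul ?_
  calc _ ≤ ∑ t ∈ Finset.range T, (1 : ℝ≥0∞) :=
        Finset.sum_le_sum fun t _ => by split_ifs <;> simp
    _ = 1 * T := by simp

lemma measurable_label (hκ : Measurable κ) {x : Ω → 𝒳} (hx : Measurable x) :
    Measurable fun p : (ℕ → Bool) × Ω => p.1 (κ (x p.2)) := by
  have h : Measurable fun p : ℕ × (ℕ → Bool) => p.2 p.1 :=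
    measurable_from_prod_countable_right fun n => measurable_pi_apply n
  exact h.comp ((hκ.comp (hx.comp measurable_snd)).prodMk measurable_fst)

lemma measurable_prediction_mem (hX : ∀ t, Measurable (X t)) (hκ : Measurable κ)
    (hO : MeasurableSet O) (t : ℕ) : Measurable fun p : (ℕ → Bool) × Ω =>
      prediction X f (fun x => y (p.1 (κ x))) t p.2 ∈ O := by
  refine measurableSet_setOfPred.1 (Measurable.comp (f.measurable_predict t) ?_ hO)
  refine Measurable.prodMk ?_ (Measurable.prodMk ?_ ((hX t).comp measurable_snd))
  · exact measurable_pi_lambda _ fun i => (hX i).comp measurable_snd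
  · exact measurable_pi_lambda _ fun i =>
      (Measurable.of_discrete (f := y)).comp (measurable_label hκ (hX i))

lemma measurable_mistakeRate (hX : ∀ t, Measurable (X t)) (hκ : Measurable κ)
    (hO : MeasurableSet O) (T : ℕ) :
    Measurable fun p : (ℕ → Bool) × Ω => mistakeRate X f κ y O T p.1 p.2 := by
  refine Measurable.div_const (Finset.measurable_sum _ fun t _ => Measurable.ite (Measurable.setOf
    ((measurable_prediction_mem hX hκ hO t).iff ?_)) measurable_const measurable_const) _
  exact (measurable_label hκ (hX t)).eq_const true

/-- On average over random labels, at least half of the first visits lead to a mistake. -/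
lemma cellRate_le_lintegral (hX : ∀ t, Measurable (X t)) (hκ : Measurable κ)
    (hO : MeasurableSet O) (T : ℕ) (ω : Ω) :
    cellRate κ X T ω ≤ 2 * ∫⁻ u, mistakeRate X f κ y O T u ω ∂coins := by
  classical
  let p : ℕ → (ℕ → Bool) → Prop := fun t u => prediction X f (fun x => y (u (κ x))) t ω ∈ O
  have hp : ∀ t, Measurable (p t) := fun t =>
    (measurable_prediction_mem hX hκ hO t).comp measurable_prodMk_right
  have hm : ∀ t, Measurable fun u : ℕ → Bool =>
      if p t u ↔ u (κ (X t ω)) = true then (0 : ℝ≥0∞) else 1 := fun t => Measurable.ite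
    ((hp t).iff ((measurable_pi_apply _).eq_const true)).setOf measurable_const measurable_const
  have h1 : ∫⁻ u, mistakeRate X f κ y O T u ω ∂coins = (∑ t ∈ Finset.range T,
      ∫⁻ u, (if p t u ↔ u (κ (X t ω)) = true then 0 else 1) ∂coins) / (T : ℝ≥0∞) := by
    rw [← lintegral_finsetSum _ fun t _ => hm t]
    simp only [mistakeRate, div_eq_mul_inv]
    rw [lintegral_mul_const _ (Finset.measurable_sum _ fun t _ => by convert hm t)]
  rw [h1, ← mul_div_assoc, Finset.mul_sum, cellRate]
  refine ENNReal.div_le_div_right ?_ _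
  rw [cells_eq_sum, Nat.cast_sum]
  refine Finset.sum_le_sum fun t _ => ?_
  split_ifs with h
  -- On a first visit no past value involves the coin of the current cell. Later visits add nothing
  -- to the count of cells.
  · rw [two_mul_lintegral_coins_eq_one (hp t) fun u => ?_, Nat.cast_one]
    have : (fun i : Fin t => y (flip (κ (X t ω)) u (κ (X i ω)))) =
        fun i : Fin t => y (u (κ (X i ω))) := by
      ext i
      rw [flip, if_neg (h i i.2)]
    simp only [p, prediction, this]
  · simp

-- As `ℓ` need not be measurable, Fubini is applied to this measurable surrogate of the loss.
omit [MeasurableSpace Ω] in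
lemma mul_mistakeRate_le {δ : ℝ≥0} (h1 : ∀ z ∈ O, δ ≤ ℓ z (y false))
    (h2 : ∀ z ∉ O, δ ≤ ℓ z (y true)) (T : ℕ) (u : ℕ → Bool) (ω : Ω) :
    δ * mistakeRate X f κ y O T u ω ≤ (avgLoss ℓ X f (fun x => y (u (κ x))) T ω : ℝ≥0∞) := by
  rw [coe_avgLoss, mistakeRate, ← mul_div_assoc, Finset.mul_sum]
  refine ENNReal.div_le_div_right (Finset.sum_le_sum fun t _ => ?_) _
  by_cases h : prediction X f (fun x => y (u (κ x))) t ω ∈ O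
  · cases hu : u (κ (X t ω))
    · simpa [h] using h1 _ h
    · simp [h]
  · cases hu : u (κ (X t ω))
    · simp [h]
    · simpa [h] using h2 _ h

lemma tendsto_zero_of_mul_le {a b : ℕ → ℝ≥0∞} {δ : ℝ≥0} (hδ : 0 < δ) (h : ∀ n, δ * a n ≤ b n)
    (hb : Tendsto b atTop (𝓝 0)) : Tendsto a atTop (𝓝 0) := by
  have hδ0 : (δ : ℝ≥0∞) ≠ 0 := by exact_mod_cast hδ.ne'
  have h1 := ENNReal.Tendsto.const_mul (a := (δ : ℝ≥0∞)⁻¹) hb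
    (Or.inr (ENNReal.inv_ne_top.2 hδ0))
  rw [mul_zero] at h1
  refine tendsto_of_tendsto_of_tendsto_of_le_of_le tendsto_const_nhds h1 (fun _ => bot_le)
    fun n => ?_
  calc a n = (δ : ℝ≥0∞)⁻¹ * (δ * a n) := by
        rw [← mul_assoc, ENNReal.inv_mul_cancel hδ0 ENNReal.coe_ne_top, one_mul]
    _ ≤ _ := by gcongr; exact h n

/-- Take `O` between two balls around one of two points at positive loss. Outside `O` one is away
from that point; inside `O` one is close to it, hence away from the other. -/
lemma IsNearMetric.exists_distinguishing_set (hℓ : IsNearMetric ℓ) (hpos : 0 < supLoss ℓ)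
    (h𝒴 : lossBorel ℓ ≤ ‹MeasurableSpace 𝒴›) :
    ∃ (y : Bool → 𝒴) (O : Set 𝒴) (δ : ℝ≥0), MeasurableSet O ∧ 0 < δ ∧
      (∀ z ∈ O, δ ≤ ℓ z (y false)) ∧ ∀ z ∉ O, δ ≤ ℓ z (y true) := by
  obtain ⟨a, ha⟩ := lt_iSup_iff.1 hpos
  obtain ⟨b, hab⟩ := lt_iSup_iff.1 ha
  have hab : 0 < ℓ a b := by exact_mod_cast hab
  obtain ⟨c, hc, htri⟩ := hℓ.exists_pos_const
  obtain ⟨δ, hδ, hO⟩ := hℓ.exists_measurableSet_between (ε := ℓ a b / (2 * c)) (by positivity)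
  obtain ⟨O, hOm, hδO, hOε⟩ := hO a
  refine ⟨fun i => if i then a else b, O, min δ (ℓ a b / (2 * c)), h𝒴 _ hOm,
    lt_min hδ (by positivity), fun z hz => (min_le_right _ _).trans ?_,
    fun z hz => (min_le_left _ _).trans ?_⟩
  · by_contra! hlt
    have h1 := hOε z hz
    rw [hℓ.symm] at h1
    have : ℓ a b < ℓ a b := calc
      ℓ a b ≤ c * (ℓ z a + ℓ z b) := htri a z b
      _ < c * (ℓ a b / (2 * c) + ℓ a b / (2 * c)) := by gcongr; simpa using hlt
      _ = ℓ a b := by field_simp; norm_num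
    exact this.false
  · by_contra! hlt
    exact hz (hδO z (by rw [hℓ.symm]; simpa using hlt))

lemma tendsto_lintegral_coins {F : ℕ → (ℕ → Bool) → ℝ≥0∞} (hF : ∀ T, Measurable (F T))
    (h1 : ∀ T u, F T u ≤ 1) (h : ∀ᵐ u ∂coins, Tendsto (fun T => F T u) atTop (𝓝 0)) :
    Tendsto (fun T => 2 * ∫⁻ u, F T u ∂coins) atTop (𝓝 0) := by
  have := tendsto_lintegral_of_dominated_convergence (μ := coins) (f := fun _ => 0) (fun _ => 1) hF
    (fun T => .of_forall (h1 T)) (by simp) h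
  rw [lintegral_zero] at this
  simpa using ENNReal.Tendsto.const_mul this (Or.inr (ENNReal.ofNat_ne_top (n := 2)))

lemma measurable_labelling (hκ : Measurable κ) (u : ℕ → Bool) :
    Measurable fun x => y (u (κ x)) :=
  (Measurable.of_discrete (f := fun k => y (u k))).comp hκ

lemma mem_SMV_of_mem_SUOL (hℓ : IsNearMetric ℓ) (hpos : 0 < supLoss ℓ)
    (h𝒴 : lossBorel ℓ ≤ ‹MeasurableSpace 𝒴›) (hX : X ∈ SUOL P ℓ) : X ∈ SMV P := by
  obtain ⟨hXm, f, hf⟩ := hX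
  obtain ⟨y, O, δ, hO, hδ, h1, h2⟩ := hℓ.exists_distinguishing_set hpos h𝒴
  refine mem_SMV_iff.2 ⟨hXm, fun κ hκ => ?_⟩
  have hm := measurable_mistakeRate (f := f) (y := y) hXm hκ hO
  have hae : ∀ u, ∀ᵐ ω ∂P, Tendsto (fun T => mistakeRate X f κ y O T u ω) atTop (𝓝 0) := by
    intro u
    filter_upwards [hf _ (measurable_labelling (y := y) hκ u)] with ω hω
    refine tendsto_zero_of_mul_le hδ (fun T => mul_mistakeRate_le h1 h2 T u ω) ?_
    rwa [← ENNReal.coe_zero, ENNReal.tendsto_coe]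
  -- The null set in `hae` depends on the labels; Fubini gives, for almost every `ω`, convergence
  -- for almost all labels.
  have hswap := (Measure.ae_ae_comm (μ := coins) (ν := P)
    (p := fun u ω => Tendsto (fun T => mistakeRate X f κ y O T u ω) atTop (𝓝 0))
    (measurableSet_tendsto _ hm)).1 (.of_forall hae)
  filter_upwards [hswap] with ω hω
  exact tendsto_of_tendsto_of_tendsto_of_le_of_le tendsto_const_nhds
    (tendsto_lintegral_coins (fun T => (hm T).comp measurable_prodMk_right)
      (fun T u => mistakeRate_le_one T u ω) hω)
    (fun _ => bot_le) fun T => cellRate_le_lintegral hXm hκ hO T ω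

lemma mem_WSMV_of_mem_WUOL (hℓ : IsNearMetric ℓ) (hpos : 0 < supLoss ℓ)
    (h𝒴 : lossBorel ℓ ≤ ‹MeasurableSpace 𝒴›) (hX : X ∈ WUOL P ℓ) : X ∈ WSMV P := by
  obtain ⟨hXm, f, hf⟩ := hX
  obtain ⟨y, O, δ, hO, hδ, h1, h2⟩ := hℓ.exists_distinguishing_set hpos h𝒴
  refine mem_WSMV_iff.2 ⟨hXm, fun κ hκ => ?_⟩
  have hm := measurable_mistakeRate (f := f) (y := y) hXm hκ hO
  have hlim : ∀ u, Tendsto (fun T => ∫⁻ ω, mistakeRate X f κ y O T u ω ∂P) atTop (𝓝 0) := by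
    intro u
    refine tendsto_zero_of_mul_le hδ (fun T => ?_) (hf _ (measurable_labelling (y := y) hκ u))
    have hmu : Measurable (mistakeRate X f κ y O T u) := (hm T).comp measurable_prodMk_left
    rw [← lintegral_const_mul _ hmu]
    exact lintegral_mono fun ω => mul_mistakeRate_le h1 h2 T u ω
  refine tendsto_of_tendsto_of_tendsto_of_le_of_le tendsto_const_nhds
    (tendsto_lintegral_coins (F := fun T u => ∫⁻ ω, mistakeRate X f κ y O T u ω ∂P)
      (fun T => (hm T).lintegral_prod_right') (fun T u => ?_) (.of_forall hlim))
    (fun _ => bot_le) fun T => ?_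
  · exact (lintegral_mono fun ω => mistakeRate_le_one T u ω).trans (by simp)
  · calc ∫⁻ ω, cellRate κ X T ω ∂P
        ≤ ∫⁻ ω, 2 * ∫⁻ u, mistakeRate X f κ y O T u ω ∂coins ∂P :=
          lintegral_mono fun ω => cellRate_le_lintegral hXm hκ hO T ω
      _ = 2 * ∫⁻ ω, ∫⁻ u, mistakeRate X f κ y O T u ω ∂coins ∂P :=
          lintegral_const_mul _ (hm T).lintegral_prod_left'
      _ = _ := by
          congr 1
          exact (lintegral_lintegral_swap (hm T).aemeasurable).symm

end Necessity

end UOL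

theorem theorem3 {𝒳 𝒴 Ω : Type*}
    [MetricSpace 𝒳] [TopologicalSpace.SeparableSpace 𝒳] [MeasurableSpace 𝒳] [BorelSpace 𝒳]
    [MeasurableSpace 𝒴] (ℓ : 𝒴 → 𝒴 → ℝ≥0)
    (hℓ : UOL.IsNearMetric ℓ) (hsep : UOL.IsSeparableLoss ℓ)
    (hpos : 0 < UOL.supLoss ℓ) (hbdd : UOL.supLoss ℓ < ∞)
    (h𝒴 : UOL.lossBorel ℓ ≤ ‹MeasurableSpace 𝒴›)
    [MeasurableSpace Ω] (P : Measure Ω) [IsProbabilityMeasure P] :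
    (UOL.SUOL P ℓ : Set (ℕ → Ω → 𝒳)) = UOL.SMV P ∧
      (UOL.WUOL P ℓ : Set (ℕ → Ω → 𝒳)) = UOL.WSMV P := by
  have := UniformSpace.secondCountable_of_separable 𝒳
  have hG := MeasurableSpace.generateFrom_natGeneratingSequence 𝒳
  have hGm := MeasurableSpace.measurableSet_natGeneratingSequence (α := 𝒳)
  obtain ⟨y₀, -⟩ := lt_iSup_iff.1 hpos
  refine ⟨Set.ext fun X => ⟨UOL.mem_SMV_of_mem_SUOL hℓ hpos h𝒴, fun hX => ⟨hX.1,
    UOL.treeRule hGm y₀, fun f hf => ?_⟩⟩, Set.ext fun X =>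
    ⟨UOL.mem_WSMV_of_mem_WUOL hℓ hpos h𝒴, fun hX => ⟨hX.1, UOL.treeRule hGm y₀, fun f hf => ?_⟩⟩⟩
  · exact UOL.stronglyConsistent_treeRule hℓ hsep hbdd h𝒴 hG hGm hX hf
  · exact UOL.weaklyConsistent_treeRule hℓ hsep hbdd h𝒴 hG hGm hX hf
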